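/- **Theorem (Linearizability).** Consider the following replication protocol (without checkpointing). In every run in which at most $f$ of the $N=3f+1$ replicas are Byzantine, for any two requests $a,b$ with $\mathit{conflict}(a,b)$: if $a$ has been executed at some correct replica $r$ at a time $t$ at which no DepPropose for $b$ has been sent yet, then 1. at every correct replica and at all times, if a slot is committed with request $b$, then its (downward closed) dependency set contains every slot holding $a$ that $r$ has executed by time $t$; 2. every correct replica that executes $b$ has executed $a$ before. Moreover, requests of the same client always conflict, and they are executed in one total order: for every client, any two correct replicas and any two times, one of the two sequences of that client's executed requests is a prefix of the other. *Setting.* The network is asynchronous (messages may be delayed, repeated, reordered or lost; timers may fire at any time). Byzantine replicas may send arbitrary messages but cannot forge signatures; hashes are collision resistant. Arbitrarily many clients may be faulty. A request consists of a client, a timestamp and a command, and is signed by its client. $\mathit{conflict}(a,b)$ holds iff $a,b$ have the same client, or from some application state executing $a$ then $b$ gives a different final state or a different result of $a$ or of $b$ than executing $b$ then $a$. *Agreement.* A slot $s=\langle i,n\rangle$ belongs to coordinator $i$; $n\in\mathbb N$ is a local counter. Each slot has its own view number, initially $-1$. - DepPropose: coordinator $i$ takes its lowest unused slot and broadcasts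 the request, a dependency set $D$ and a set $F$ of $2f$ followers. $D$ contains, for each coordinator, the latest slot for which the replica has learned a conflicting request. - DepVerify: a follower processes only the first valid DepPropose of a slot, after it knows that consensus was initiated for all slots in $D$ and for the coordinator's preceding slot (it accepted a DepPropose for them, or received $f+1$ DepVerifys or $f+1$ ViewChanges). Members of $F$ broadcast their own dependency set for the request. - A replica that has collected matching DepVerifys $\vec{dv}$ from all of $F$, and knows that consensus was initiated for all slots in them, broadcasts DepCommit$(\vec{dv})$ if every dependency in $\vec{dv}$ occurs in at least $f+1$ of its messages; otherwise it broadcasts Prepare$(-1,\vec{dv})$. After DepCommit, $2f+1$ matching DepCommits commit the slot. After Prepare, $2f+1$ matching Prepares of its view lead it to broadcast Commit, and then $2f+1$ matching Commits of its view commit the slot. What is committed is the request together with the union of the dependency sets in the DepPropose and in $\vec{dv}$. - View change: a replica moves to the next view of an initiated slot on a timeout, or to the $(f+1)$-highest received view when that exceeds its own. It stops processing older views and broadcasts a ViewChange with its newest certificate: a reconciliation certificate (proposal, $\vec{dv}$, and $2f+1$ matching Prepares of one view) if it had prepared, a fast-path certificate (DepPropose, $\vec{dv}$) if it had sent DepCommit,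 or none. The coordinator $(i+\max(0,v))\bmod N$ of view $v$ broadcasts a NewView built from $2f+1$ valid ViewChanges for $v$. It selects the reconciliation certificate of highest view; failing that, a fast-path certificate; failing that, a no-op without dependencies. Replicas check the NewView, enter the view and resume with Prepare. - A replica also regards a slot as committed after $f+1$ matching reports that it is. *Execution.* A dependency on a slot includes all earlier slots of the same coordinator. Only slots inside the window are executed, namely, for each coordinator, the slots whose counter is less than $k$ above that of its oldest not yet executed slot. For a committed slot $v$, a replica expands the graph of not yet executed slots reachable from $v$ by dependencies. If all of them are committed and inside the window, it executes the strongly connected components in inverse topological order, each sorted by slot number. If no slot can be executed in this way, it may ignore dependencies on slots beyond the window: when the graph from $v$ restricted to the window is committed, it executes the first component only. No-ops are skipped, and so is a request if a request of the same client with the same timestamp has been executed before. -/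

import Mathlib

/-! # A leaderless Byzantine fault-tolerant replication protocol with per-request dependencies

`3 * f + 1` replicas, of which at most `f` are Byzantine, agree for every agreement slot on a
request and a dependency set, and execute committed slots in an order that is computed from these
dependency sets.  The network is asynchronous: `sent` is the set of all messages ever sent, and any
of them may be received at any later time, repeatedly, or never.  Timers may fire at any time.

Cryptography is symbolic.  A collision-resistant hash of an object is represented by the object.
A signature is represented by the sender recorded in the message: replicas only look at messages in
`sent` (also inside certificates), and only the sender itself can put a message there. -/

namespace Isos

/-- The replicas. -/
abbrev Replica (f : ℕ) := Fin (3 * f + 1)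

/-- An agreement slot `⟨coord, seq⟩`: the request coordinator and its local counter. -/
structure Slot (f : ℕ) where
  coord : Replica f
  seq : ℕ

/-- A client request: command `op` of client `client` with client-local timestamp. -/
structure Request (Client Op : Type*) where
  client : Client
  timestamp : ℕ
  op : Op

/-- Two requests conflict if they are issued by the same client, or if their effects (on the
application state) or their outcomes (results) vary with the relative order of their execution. -/
def Conflict {Client Op AppState Result : Type*}
    (app : AppState → Client → Op → AppState × Result) (a b : Request Client Op) : Prop :=
  a.client = b.client ∨
    ∃ st : AppState,
      let a₁ := app st a.client a.op
      let b₂ := app a₁.1 b.client b.op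
      let b₁ := app st b.client b.op
      let a₂ := app b₁.1 a.client a.op
      b₂.1 ≠ a₂.1 ∨ a₁.2 ≠ a₂.2 ∨ b₁.2 ≠ b₂.2

/-- `S` consists of `n` messages from `n` different senders. -/
def FromDistinct {M : Type*} {f : ℕ} (n : ℕ) (sender : M → Replica f) (S : Finset M) : Prop :=
  S.card = n ∧ ∀ x ∈ S, ∀ y ∈ S, sender x = sender y → x = y

noncomputable section

/-! ## Messages -/

/-- `DepPropose`, signed by the coordinator `slot.coord` of its slot, with the (hash of the)
request, the coordinator's dependency set and the fast-path quorum. -/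
structure DepPropose (f : ℕ) (Client Op : Type*) where
  slot : Slot f
  req : Request Client Op
  deps : Finset (Slot f)
  quorum : Finset (Replica f)

/-- `DepVerify` for the slot `prop.slot`, with the (hash of the) matching `DepPropose`. -/
structure DepVerify (f : ℕ) (Client Op : Type*) where
  sender : Replica f
  prop : DepPropose f Client Op
  deps : Finset (Slot f)

/-- `DepCommit` with the (hash of the) set of collected `DepVerify`s. -/
structure DepCommit (f : ℕ) (Client Op : Type*) where
  slot : Slot f
  sender : Replica f
  dv : Finset (DepVerify f Client Op)

/-- `Prepare` of the reconciliation path. -/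
structure Prepare (f : ℕ) (Client Op : Type*) where
  view : ℤ
  slot : Slot f
  sender : Replica f
  dv : Finset (DepVerify f Client Op)

/-- `Commit` of the reconciliation path. -/
structure Commit (f : ℕ) (Client Op : Type*) where
  view : ℤ
  slot : Slot f
  sender : Replica f
  dv : Finset (DepVerify f Client Op)

/-- The certificate in a `ViewChange`: none, a fast-path certificate, or a reconciliation-path
certificate (whose proposal is `none` if it certifies a no-op). -/
inductive Cert (f : ℕ) (Client Op : Type*) where
  | none : Cert f Client Op
  | fpc (prop : DepPropose f Client Op) (dv : Finset (DepVerify f Client Op)) : Cert f Client Op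
  | rpc (prop : Option (DepPropose f Client Op)) (dv : Finset (DepVerify f Client Op))
      (preps : Finset (Prepare f Client Op)) (view : ℤ) : Cert f Client Op

structure ViewChange (f : ℕ) (Client Op : Type*) where
  view : ℤ
  slot : Slot f
  sender : Replica f
  cert : Cert f Client Op

/-- `NewView`, signed by the view-change coordinator of the slot and view. -/
structure NewView (f : ℕ) (Client Op : Type*) where
  view : ℤ
  slot : Slot f
  prop : Option (DepPropose f Client Op)
  dv : Finset (DepVerify f Client Op)
  vcs : Finset (ViewChange f Client Op)

/-- What is committed for a slot: a request (`none` is the no-op) and a dependency set. -/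
abbrev Decision (f : ℕ) (Client Op : Type*) := Option (Request Client Op) × Finset (Slot f)

/-- `Exec` reports a committed slot to lagging replicas. -/
structure Exec (f : ℕ) (Client Op : Type*) where
  slot : Slot f
  sender : Replica f
  decision : Decision f Client Op

inductive Msg (f : ℕ) (Client Op : Type*) where
  | depPropose : DepPropose f Client Op → Msg f Client Op
  | depVerify : DepVerify f Client Op → Msg f Client Op
  | depCommit : DepCommit f Client Op → Msg f Client Op
  | prepare : Prepare f Client Op → Msg f Client Op
  | commit : Commit f Client Op → Msg f Client Op
  | viewChange : ViewChange f Client Op → Msg f Client Op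
  | newView : NewView f Client Op → Msg f Client Op
  | exec : Exec f Client Op → Msg f Client Op

/-- The view-change coordinator `(s.coord + max 0 v) mod N` of slot `s` in view `v`. -/
def viewCoord {f : ℕ} (s : Slot f) (v : ℤ) : Replica f :=
  ⟨(s.coord.val + v.toNat) % (3 * f + 1), Nat.mod_lt _ (Nat.succ_pos _)⟩

/-- The replica whose signature a message carries. -/
def Msg.signer {f : ℕ} {Client Op : Type*} : Msg f Client Op → Replica f
  | .depPropose m => m.slot.coord
  | .depVerify m => m.sender
  | .depCommit m => m.sender
  | .prepare m => m.sender
  | .commit m => m.sender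
  | .viewChange m => m.sender
  | .newView m => viewCoord m.slot m.view
  | .exec m => m.sender

/-! ## Predicates on messages -/

/-- A fast-path quorum consists of `2 * f` followers. -/
def ValidQuorum {f : ℕ} {Client Op : Type*} (p : DepPropose f Client Op) : Prop :=
  p.quorum.card = 2 * f ∧ p.slot.coord ∉ p.quorum

/-- `dv` consists of exactly one received `DepVerify` for `p` from each member of its quorum. -/
def Verified {f : ℕ} {Client Op : Type*} (sent : Set (Msg f Client Op))
    (p : DepPropose f Client Op) (dv : Finset (DepVerify f Client Op)) : Prop :=
  FromDistinct (2 * f) DepVerify.sender dv ∧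
    ∀ m ∈ dv, Msg.depVerify m ∈ sent ∧ m.prop = p ∧ m.sender ∈ p.quorum

open Classical in
/-- Each dependency in the `DepVerify`s occurs in at least `f + 1` of them. -/
def FastOK {f : ℕ} {Client Op : Type*} (dv : Finset (DepVerify f Client Op)) : Prop :=
  ∀ m ∈ dv, ∀ d ∈ m.deps, f + 1 ≤ (dv.filter (fun m' => d ∈ m'.deps)).card

/-- The certificate is a valid one for slot `s` in a `ViewChange` for view `v`. -/
def Cert.Valid {f : ℕ} {Client Op : Type*} (sent : Set (Msg f Client Op)) (s : Slot f) (v : ℤ) :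
    Cert f Client Op → Prop
  | .none => True
  | .fpc p dv => p.slot = s ∧ Msg.depPropose p ∈ sent ∧ ValidQuorum p ∧ Verified sent p dv ∧
      FastOK dv
  | .rpc p dv preps w => -1 ≤ w ∧ w < v ∧
      (p = Option.none → dv = ∅) ∧
      (∀ q, p = some q → q.slot = s ∧ Msg.depPropose q ∈ sent ∧ ValidQuorum q ∧
        Verified sent q dv) ∧
      FromDistinct (2 * f + 1) Prepare.sender preps ∧
      ∀ m ∈ preps, Msg.prepare m ∈ sent ∧ m.slot = s ∧ m.view = w ∧ m.dv = dv

/-- The result of a view change: the reconciliation-path certificate of the highest view if there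
is one, else a fast-path certificate if there is one, else a no-op without dependencies. -/
def Selects {f : ℕ} {Client Op : Type*} (vcs : Finset (ViewChange f Client Op))
    (p : Option (DepPropose f Client Op)) (dv : Finset (DepVerify f Client Op)) : Prop :=
  (∃ m ∈ vcs, ∃ preps w, m.cert = .rpc p dv preps w ∧
    ∀ m' ∈ vcs, ∀ p' dv' preps' w', m'.cert = .rpc p' dv' preps' w' → w' ≤ w) ∨
  ((∀ m ∈ vcs, ∀ p' dv' preps' w', m.cert ≠ .rpc p' dv' preps' w') ∧
    ∃ m ∈ vcs, ∃ q, p = some q ∧ m.cert = .fpc q dv) ∨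
  ((∀ m ∈ vcs, m.cert = .none) ∧ p = none ∧ dv = ∅)

/-- The `NewView` is correctly computed from `2 * f + 1` valid `ViewChange`s. -/
def NewView.Valid {f : ℕ} {Client Op : Type*} (sent : Set (Msg f Client Op))
    (nv : NewView f Client Op) : Prop :=
  FromDistinct (2 * f + 1) ViewChange.sender nv.vcs ∧
  (∀ m ∈ nv.vcs, Msg.viewChange m ∈ sent ∧ m.slot = nv.slot ∧ m.view = nv.view ∧
    m.cert.Valid sent nv.slot nv.view) ∧
  Selects nv.vcs nv.prop nv.dv

/-! ## The state of a replica -/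

inductive Phase where
  | init
  | proposed
  | fpVerified
  | fpCommitted
  | rpVerified
  | rpPrepared
  | rpCommitted
  | viewChange

/-- What a replica stores for a slot: the accepted proposal (`none` if there is none, or if a view
change replaced it by a no-op), the phase, the view, the collected `DepVerify`s, the newest
certificate, and the decision once the slot is committed. -/
structure SlotState (f : ℕ) (Client Op : Type*) where
  prop : Option (DepPropose f Client Op)
  phase : Phase
  view : ℤ
  dv : Finset (DepVerify f Client Op)
  cert : Cert f Client Op
  exec : Option (Decision f Client Op)

/-- The state of a replica: its lowest unused sequence number, all requests that it has learned in
the agreement of a slot, its slots, and the slots it has executed, in the order of execution. -/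
structure Local (f : ℕ) (Client Op : Type*) where
  next : ℕ
  known : Finset (Slot f × Request Client Op)
  slots : Slot f → SlotState f Client Op
  done : List (Slot f)

def Local.initial (f : ℕ) (Client Op : Type*) : Local f Client Op where
  next := 0
  known := ∅
  slots := fun _ => ⟨none, .init, -1, ∅, .none, none⟩
  done := []

open Classical in
def Local.setSlot {f : ℕ} {Client Op : Type*} (L : Local f Client Op) (s : Slot f)
    (S : SlotState f Client Op) : Local f Client Op :=
  { L with slots := Function.update L.slots s S }

open Classical in
def Local.learn {f : ℕ} {Client Op : Type*} (L : Local f Client Op) (s : Slot f)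
    (r : Request Client Op) : Local f Client Op :=
  { L with known := insert (s, r) L.known }

open Classical in
/-- The compact dependency set of request `r`: for each coordinator, the latest slot for which a
conflicting request is known. -/
def Local.conflicts {f : ℕ} {Client Op : Type*}
    (conf : Request Client Op → Request Client Op → Prop)
    (L : Local f Client Op) (r : Request Client Op) : Finset (Slot f) :=
  let C := (L.known.filter (fun x => conf x.2 r)).image Prod.fst
  C.filter (fun s => ∀ s' ∈ C, s'.coord = s.coord → s'.seq ≤ s.seq)

open Classical in
/-- The request of the current proposal, with the union of the dependency sets of the `DepPropose`
and the `DepVerify`s. -/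
def SlotState.decision {f : ℕ} {Client Op : Type*} (S : SlotState f Client Op) :
    Decision f Client Op :=
  (S.prop.map DepPropose.req,
    S.prop.elim ∅ DepPropose.deps ∪ S.dv.biUnion DepVerify.deps)

/-- Record the current decision as committed, unless the slot is committed already. -/
def SlotState.decide {f : ℕ} {Client Op : Type*} (S : SlotState f Client Op) :
    SlotState f Client Op :=
  { S with exec := some (S.exec.getD S.decision) }

/-- The replica knows that the consensus for slot `s` has been initiated: it has accepted a
`DepPropose`, or received `f + 1` `DepVerify`s or `f + 1` `ViewChange`s. -/
def Started {f : ℕ} {Client Op : Type*} (sent : Set (Msg f Client Op)) (L : Local f Client Op)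
    (s : Slot f) : Prop :=
  (L.slots s).prop ≠ none ∨
  (∃ M : Finset (DepVerify f Client Op), FromDistinct (f + 1) DepVerify.sender M ∧
    ∀ m ∈ M, Msg.depVerify m ∈ sent ∧ m.prop.slot = s) ∨
  (∃ M : Finset (ViewChange f Client Op), FromDistinct (f + 1) ViewChange.sender M ∧
    ∀ m ∈ M, Msg.viewChange m ∈ sent ∧ m.slot = s)

/-- Follower `i` may process proposal `p`: it is signed by the coordinator of the slot, it has a
valid quorum, no other `DepPropose` has been accepted for the slot, and the consensus for its
dependencies and for the preceding slot of the coordinator has been initiated. -/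
def Acceptable {f : ℕ} {Client Op : Type*} (sent : Set (Msg f Client Op)) (i : Replica f)
    (L : Local f Client Op) (p : DepPropose f Client Op) : Prop :=
  Msg.depPropose p ∈ sent ∧ p.slot.coord ≠ i ∧ ValidQuorum p ∧
  (L.slots p.slot).phase = .init ∧
  (∀ q, (L.slots p.slot).prop = some q → q = p) ∧
  (∀ d ∈ p.deps, Started sent L d) ∧
  (∀ n, p.slot.seq = n + 1 → Started sent L ⟨p.slot.coord, n⟩)

/-- The certificate `c` that a replica reports when it leaves the current view. -/
def SlotState.NewestCert {f : ℕ} {Client Op : Type*} (sent : Set (Msg f Client Op)) (s : Slot f)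
    (S : SlotState f Client Op) (c : Cert f Client Op) : Prop :=
  match S.phase with
  | .fpVerified | .fpCommitted => ∃ p, S.prop = some p ∧ c = .fpc p S.dv
  | .rpPrepared | .rpCommitted => ∃ preps : Finset (Prepare f Client Op),
      FromDistinct (2 * f + 1) Prepare.sender preps ∧
      (∀ m ∈ preps, Msg.prepare m ∈ sent ∧ m.slot = s ∧ m.view = S.view ∧ m.dv = S.dv) ∧
      c = .rpc S.prop S.dv preps S.view
  | _ => c = S.cert

/-- A reason to move to view `v` of slot `s`: the timer of the current view expired (it runs once
the slot is known to be initiated), or `v` is the `(f + 1)`-highest among received view numbers. -/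
def ViewChangeTrigger {f : ℕ} {Client Op : Type*} (sent : Set (Msg f Client Op))
    (L : Local f Client Op) (s : Slot f) (v : ℤ) : Prop :=
  (Started sent L s ∧ v = (L.slots s).view + 1) ∨
  ((L.slots s).view < v ∧
    ∃ M : Finset (ViewChange f Client Op), FromDistinct (f + 1) ViewChange.sender M ∧
      (∀ m ∈ M, Msg.viewChange m ∈ sent ∧ m.slot = s ∧ v ≤ m.view) ∧ ∃ m ∈ M, m.view = v)

/-- The state of a replica after following `nv` into its view; a proposal in `nv` becomes known. -/
def Local.enter {f : ℕ} {Client Op : Type*} (L : Local f Client Op) (nv : NewView f Client Op) :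
    Local f Client Op :=
  let L' := match nv.prop with
    | some p => L.learn nv.slot p.req
    | none => L
  L'.setSlot nv.slot { L.slots nv.slot with prop := nv.prop, dv := nv.dv, phase := .rpVerified }

/-! ## Execution -/

/-- Slot `v` is a dependency of the committed slot `u`.  A compact dependency set contains, with a
slot, all earlier slots of the same coordinator. -/
def Local.Dep {f : ℕ} {Client Op : Type*} (L : Local f Client Op) (u v : Slot f) : Prop :=
  ∃ x, (L.slots u).exec = some x ∧ ∃ d ∈ x.2, v.coord = d.coord ∧ v.seq ≤ d.seq

def Local.committed {f : ℕ} {Client Op : Type*} (L : Local f Client Op) : Set (Slot f) :=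
  {v | (L.slots v).exec ≠ none}

/-- The slots that are not yet executed. -/
def Local.pending {f : ℕ} {Client Op : Type*} (L : Local f Client Op) : Set (Slot f) :=
  {v | v ∉ L.done}

/-- The sequence number of the oldest slot of coordinator `i` that is not yet executed. -/
def Local.root {f : ℕ} {Client Op : Type*} (L : Local f Client Op) (i : Replica f) : ℕ :=
  sInf {n | (⟨i, n⟩ : Slot f) ∉ L.done}

/-- The execution window: for each coordinator, the slots below the expansion limit. -/
def Local.window {f : ℕ} {Client Op : Type*} (L : Local f Client Op) (k : ℕ) : Set (Slot f) :=
  {v | v.seq < L.root v.coord + k}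

/-- The nodes of the dependency graph that is expanded from `v` inside the set `A`. -/
def Local.rdeps {f : ℕ} {Client Op : Type*} (L : Local f Client Op) (A : Set (Slot f))
    (v : Slot f) : Set (Slot f) :=
  {u | v ∈ A ∧ Relation.ReflTransGen (fun x y => L.Dep x y ∧ y ∈ A) v u}

/-- `S` is a strongly connected component of the dependency graph on `G` that may come first in
an inverse topological order, that is, no edge leads from `S` to another component. -/
def Local.IsFirstComponent {f : ℕ} {Client Op : Type*} (L : Local f Client Op)
    (G S : Set (Slot f)) : Prop :=
  S.Nonempty ∧ S ⊆ G ∧ (∀ x ∈ S, ∀ y ∈ S, y ∈ L.rdeps G x) ∧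
    ∀ x ∈ S, ∀ y ∈ G, L.Dep x y → y ∈ S

/-- Normal case: the dependency graph of `v` is committed and inside the window. -/
def Local.NormalReady {f : ℕ} {Client Op : Type*} (L : Local f Client Op) (k : ℕ)
    (v : Slot f) : Prop :=
  v ∈ L.pending ∧ L.rdeps L.pending v ⊆ L.committed ∩ L.window k

/-- Unblock case: no slot can be executed normally, and `v` is only blocked by slots beyond the
window. -/
def Local.UnblockReady {f : ℕ} {Client Op : Type*} (L : Local f Client Op) (k : ℕ)
    (v : Slot f) : Prop :=
  (∀ u, ¬ L.NormalReady k u) ∧ v ∈ L.pending ∩ L.window k ∧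
    L.rdeps (L.pending ∩ L.window k) v ⊆ L.committed

/-- The order in which the slots of one component are executed: by sequence number, ties broken by
the coordinator. -/
def SlotBefore {f : ℕ} (u v : Slot f) : Prop :=
  u.seq < v.seq ∨ (u.seq = v.seq ∧ u.coord < v.coord)

open Classical in
/-- Running a sequence of requests on the application: a request is skipped as a duplicate if a
request of the same client with the same timestamp has been run before. -/
def runRequests {Client Op : Type*} (l : List (Request Client Op)) : List (Request Client Op) :=
  l.foldl (fun acc r =>
    if ∃ q ∈ acc, q.client = r.client ∧ q.timestamp = r.timestamp then acc else acc ++ [r]) []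

/-- The requests that the replica has executed, in the order of execution.  No-ops are skipped. -/
def Local.log {f : ℕ} {Client Op : Type*} (L : Local f Client Op) : List (Request Client Op) :=
  runRequests (L.done.filterMap (fun s => (L.slots s).exec.bind Prod.fst))

/-! ## The steps of the protocol -/

/-- `LocalStep conf k issued sent i L L' out`: the correct replica `i` can move from state `L` to
state `L'` and broadcast the messages in `out`, when the clients have issued (signed) the requests
in `issued` and the messages in `sent` have been sent.  The window size is `k`. -/
inductive LocalStep {f : ℕ} {Client Op : Type*}
    (conf : Request Client Op → Request Client Op → Prop) (k : ℕ)
    (issued : Set (Request Client Op)) (sent : Set (Msg f Client Op)) (i : Replica f) :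
    Local f Client Op → Local f Client Op → Set (Msg f Client Op) → Prop
  /-- The coordinator proposes a request in its next slot. -/
  | propose (L : Local f Client Op) (p : DepPropose f Client Op)
      (hslot : p.slot = ⟨i, L.next⟩) (hphase : (L.slots p.slot).phase = .init)
      (hreq : p.req ∈ issued) (hdeps : p.deps = L.conflicts conf p.req) (hq : ValidQuorum p) :
      LocalStep conf k issued sent i L
        { (L.learn p.slot p.req).setSlot p.slot
            { L.slots p.slot with prop := some p, phase := .proposed } with next := L.next + 1 }
        {Msg.depPropose p}
  /-- A follower accepts a forwarded `DepPropose`, which comes without the request. -/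
  | acceptHeader (L : Local f Client Op) (p : DepPropose f Client Op)
      (hp : Acceptable sent i L p) :
      LocalStep conf k issued sent i L
        (L.setSlot p.slot { L.slots p.slot with prop := some p }) ∅
  /-- A follower processes a `DepPropose` together with its request, and answers with a
  `DepVerify` if it is a member of the fast-path quorum. -/
  | accept (L : Local f Client Op) (p : DepPropose f Client Op)
      (hp : Acceptable sent i L p) (hreq : p.req ∈ issued) :
      LocalStep conf k issued sent i L
        ((L.learn p.slot p.req).setSlot p.slot
          { L.slots p.slot with prop := some p, phase := .proposed })
        {m | i ∈ p.quorum ∧ m = .depVerify ⟨i, p, L.conflicts conf p.req⟩}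
  /-- A replica that has collected the `DepVerify`s with sufficiently reported dependencies
  continues on the fast path. -/
  | fpVerify (L : Local f Client Op) (p : DepPropose f Client Op)
      (dv : Finset (DepVerify f Client Op))
      (hphase : (L.slots p.slot).phase = .proposed) (hprop : (L.slots p.slot).prop = some p)
      (hdv : Verified sent p dv) (hwait : ∀ m ∈ dv, ∀ d ∈ m.deps, Started sent L d)
      (hfast : FastOK dv) :
      LocalStep conf k issued sent i L
        (L.setSlot p.slot { L.slots p.slot with dv := dv, phase := .fpVerified })
        {.depCommit ⟨p.slot, i, dv⟩}
  /-- Otherwise it switches to the reconciliation path. -/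
  | rpVerify (L : Local f Client Op) (p : DepPropose f Client Op)
      (dv : Finset (DepVerify f Client Op))
      (hphase : (L.slots p.slot).phase = .proposed) (hprop : (L.slots p.slot).prop = some p)
      (hdv : Verified sent p dv) (hwait : ∀ m ∈ dv, ∀ d ∈ m.deps, Started sent L d)
      (hslow : ¬ FastOK dv) :
      LocalStep conf k issued sent i L
        (L.setSlot p.slot { L.slots p.slot with dv := dv, phase := .rpVerified })
        {.prepare ⟨(L.slots p.slot).view, p.slot, i, dv⟩}
  /-- `2 * f + 1` matching `DepCommit`s commit the slot on the fast path. -/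
  | fpCommit (L : Local f Client Op) (s : Slot f) (M : Finset (DepCommit f Client Op))
      (hphase : (L.slots s).phase = .fpVerified)
      (hM : FromDistinct (2 * f + 1) DepCommit.sender M)
      (hmatch : ∀ m ∈ M, Msg.depCommit m ∈ sent ∧ m.slot = s ∧ m.dv = (L.slots s).dv) :
      LocalStep conf k issued sent i L
        (L.setSlot s { (L.slots s).decide with phase := .fpCommitted }) ∅
  /-- `2 * f + 1` matching `Prepare`s prepare the slot on the reconciliation path. -/
  | rpPrepare (L : Local f Client Op) (s : Slot f) (M : Finset (Prepare f Client Op))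
      (hphase : (L.slots s).phase = .rpVerified)
      (hM : FromDistinct (2 * f + 1) Prepare.sender M)
      (hmatch : ∀ m ∈ M, Msg.prepare m ∈ sent ∧ m.slot = s ∧ m.view = (L.slots s).view ∧
        m.dv = (L.slots s).dv) :
      LocalStep conf k issued sent i L
        (L.setSlot s { L.slots s with phase := .rpPrepared })
        {.commit ⟨(L.slots s).view, s, i, (L.slots s).dv⟩}
  /-- `2 * f + 1` matching `Commit`s commit the slot on the reconciliation path. -/
  | rpCommit (L : Local f Client Op) (s : Slot f) (M : Finset (Commit f Client Op))
      (hphase : (L.slots s).phase = .rpPrepared)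
      (hM : FromDistinct (2 * f + 1) Commit.sender M)
      (hmatch : ∀ m ∈ M, Msg.commit m ∈ sent ∧ m.slot = s ∧ m.view = (L.slots s).view ∧
        m.dv = (L.slots s).dv) :
      LocalStep conf k issued sent i L
        (L.setSlot s { (L.slots s).decide with phase := .rpCommitted }) ∅
  /-- The replica aborts its view of a slot and reports its newest certificate. -/
  | viewChange (L : Local f Client Op) (s : Slot f) (v : ℤ) (c : Cert f Client Op)
      (htrigger : ViewChangeTrigger sent L s v) (hc : (L.slots s).NewestCert sent s c) :
      LocalStep conf k issued sent i L
        (L.setSlot s { L.slots s with view := v, phase := .viewChange, cert := c })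
        {.viewChange ⟨v, s, i, c⟩}
  /-- The view-change coordinator installs the new view. -/
  | sendNewView (L : Local f Client Op) (nv : NewView f Client Op)
      (hcoord : viewCoord nv.slot nv.view = i)
      (hphase : (L.slots nv.slot).phase = .viewChange) (hview : (L.slots nv.slot).view = nv.view)
      (hvalid : nv.Valid sent) :
      LocalStep conf k issued sent i L (L.enter nv)
        {.newView nv, .prepare ⟨nv.view, nv.slot, i, nv.dv⟩}
  /-- The other replicas follow the coordinator and resume the reconciliation path. -/
  | acceptNewView (L : Local f Client Op) (nv : NewView f Client Op)
      (hsent : Msg.newView nv ∈ sent)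
      (hphase : (L.slots nv.slot).phase = .viewChange) (hview : (L.slots nv.slot).view = nv.view)
      (hvalid : nv.Valid sent) :
      LocalStep conf k issued sent i L (L.enter nv)
        {.prepare ⟨nv.view, nv.slot, i, nv.dv⟩}
  /-- The replica reports a committed slot. -/
  | sendExec (L : Local f Client Op) (s : Slot f) (x : Decision f Client Op)
      (hx : (L.slots s).exec = some x) :
      LocalStep conf k issued sent i L L {.exec ⟨s, i, x⟩}
  /-- A lagging replica regards a slot as committed after `f + 1` matching reports. -/
  | learnExec (L : Local f Client Op) (s : Slot f) (x : Decision f Client Op)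
      (M : Finset (Exec f Client Op)) (hnone : (L.slots s).exec = none)
      (hM : FromDistinct (f + 1) Exec.sender M)
      (hmatch : ∀ m ∈ M, Msg.exec m ∈ sent ∧ m.slot = s ∧ m.decision = x) :
      LocalStep conf k issued sent i L (L.setSlot s { L.slots s with exec := some x }) ∅
  /-- Normal case of the execution: the next component of a dependency graph is executed. -/
  | executeNormal (L : Local f Client Op) (v : Slot f) (l : List (Slot f))
      (hv : L.NormalReady k v) (hl : l.Pairwise SlotBefore)
      (hcomp : L.IsFirstComponent (L.rdeps L.pending v) {u | u ∈ l}) :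
      LocalStep conf k issued sent i L { L with done := L.done ++ l } ∅
  /-- Unblock case of the execution: dependencies on slots beyond the window are ignored, and one
  component is executed. -/
  | executeUnblock (L : Local f Client Op) (v : Slot f) (l : List (Slot f))
      (hv : L.UnblockReady k v) (hl : l.Pairwise SlotBefore)
      (hcomp : L.IsFirstComponent (L.rdeps (L.pending ∩ L.window k) v) {u | u ∈ l}) :
      LocalStep conf k issued sent i L { L with done := L.done ++ l } ∅

/-- A configuration of the whole system. -/
structure Config (f : ℕ) (Client Op : Type*) where
  issued : Set (Request Client Op)
  sent : Set (Msg f Client Op)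
  loc : Replica f → Local f Client Op

def Config.initial (f : ℕ) (Client Op : Type*) : Config f Client Op where
  issued := ∅
  sent := ∅
  loc := fun _ => Local.initial f Client Op

open Classical in
/-- The steps of the system. -/
inductive Step {f : ℕ} {Client Op : Type*}
    (conf : Request Client Op → Request Client Op → Prop) (k : ℕ) (faulty : Finset (Replica f)) :
    Config f Client Op → Config f Client Op → Prop
  /-- Nothing happens. -/
  | idle (c : Config f Client Op) : Step conf k faulty c c
  /-- A (correct or faulty) client issues a request. -/
  | issue (c : Config f Client Op) (r : Request Client Op) :
      Step conf k faulty c { c with issued := insert r c.issued }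
  /-- A faulty replica sends an arbitrary message under its own signature. -/
  | byzantine (c : Config f Client Op) (m : Msg f Client Op) (hm : m.signer ∈ faulty) :
      Step conf k faulty c { c with sent := insert m c.sent }
  /-- A correct replica makes a step of the protocol. -/
  | correct (c : Config f Client Op) (i : Replica f) (L' : Local f Client Op)
      (out : Set (Msg f Client Op)) (hi : i ∉ faulty)
      (hstep : LocalStep conf k c.issued c.sent i (c.loc i) L' out) :
      Step conf k faulty c
        { c with sent := c.sent ∪ out, loc := Function.update c.loc i L' }

/-- A run of the system; `σ t` is the configuration after `t` steps. -/
def IsRun {f : ℕ} {Client Op : Type*} (conf : Request Client Op → Request Client Op → Prop)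
    (k : ℕ) (faulty : Finset (Replica f)) (σ : ℕ → Config f Client Op) : Prop :=
  σ 0 = Config.initial f Client Op ∧ ∀ t, Step conf k faulty (σ t) (σ (t + 1))

/-- Some replica has sent a `DepPropose` for request `r`. -/
def Config.Proposed {f : ℕ} {Client Op : Type*} (c : Config f Client Op)
    (r : Request Client Op) : Prop :=
  ∃ p : DepPropose f Client Op, Msg.depPropose p ∈ c.sent ∧ p.req = r

open Classical in
/-- The requests of client `x` that the replica has executed, in the order of execution. -/
def Local.clientLog {f : ℕ} {Client Op : Type*} (L : Local f Client Op) (x : Client) :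
    List (Request Client Op) :=
  L.log.filter (fun r => r.client = x)

end

end Isos

/-! Safety rests on one counting fact: two sets of 2f+1 replicas share at least f+1 members, hence a
correct one. `SlotInv` records what a correct replica has bound itself to by the messages it has
sent for a slot.

Agreement. A decision is backed by 2f+1 Commits or 2f+1 DepCommits. A view from 0 on is entered only
through a NewView built from 2f+1 ViewChanges, and one of these comes from a correct member of the
backing quorum, which must report a certificate. By induction on the view, a Commit quorum fixes the
set of DepVerifys that can be prepared later (`HasCommits.lock`). A DepCommit quorum fixes less,
since faulty followers may equivocate in their DepVerifys: it fixes the proposal and the union of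
the dependencies (`HasDepCommits.lock`). That is enough: on the fast path each dependency is
reported by f+1 followers, so by a correct one, which reports only once. Hence decisions are unique
(`Justified.unique`, `IsRun.agreement`).

Dependencies. The dependency set of a committed request collects the reports of the coordinator and
2f followers. For two conflicting requests in different slots these groups share a correct replica,
and its later report covers the slot of its earlier one (`IsRun.covers_of_conflict`). If `b` was not
yet proposed when `a` was committed, the report on `b` is the later one, which gives the first
claim.

Execution. By agreement there is one dependency graph `RunDep`, of which every correct replica sees
the part that is committed locally. The normal case and the unblock case are both instances of
`Enabled`: a strongly connected component inside the window is executed that has no edge to the rest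
of the window. Two different enabled components are disjoint and independent, and executing one
leaves the other enabled (`Enabled.after`), although the window moves. This diamond property makes
execution confluent: any two correct replicas order dependent slots alike (`ExecSeq.order`), and of
two dependent slots they cannot each have executed only one, and a different one
(`ExecSeq.mem_or_mem`). Conflicting requests occupy dependent slots, so the second claim and the
prefix property follow. Suppressing duplicates does no harm, because a duplicate has the same
client, so it conflicts and is ordered alike everywhere. -/

namespace Isos

variable {f : ℕ} {Client Op : Type*}

/-! ## Messages and certificates -/

/-- The slot that a message is about. -/
def Msg.slot : Msg f Client Op → Slot f
  | .depPropose m => m.slot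
  | .depVerify m => m.prop.slot
  | .depCommit m => m.slot
  | .prepare m => m.slot
  | .commit m => m.slot
  | .viewChange m => m.slot
  | .newView m => m.slot
  | .exec m => m.slot

/-- A proposal (or no-op) and the `DepVerify`s that belong to it. -/
def ValidPair (sent : Set (Msg f Client Op)) (s : Slot f)
    (prop : Option (DepPropose f Client Op)) (dv : Finset (DepVerify f Client Op)) : Prop :=
  (prop = none → dv = ∅) ∧
    ∀ p, prop = some p → p.slot = s ∧ Msg.depPropose p ∈ sent ∧ ValidQuorum p ∧ Verified sent p dv

def HasPrepares (sent : Set (Msg f Client Op)) (s : Slot f) (w : ℤ)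
    (dv : Finset (DepVerify f Client Op)) : Prop :=
  ∃ M : Finset (Prepare f Client Op), FromDistinct (2 * f + 1) Prepare.sender M ∧
    ∀ m ∈ M, Msg.prepare m ∈ sent ∧ m.slot = s ∧ m.view = w ∧ m.dv = dv

def HasCommits (sent : Set (Msg f Client Op)) (s : Slot f) (w : ℤ)
    (dv : Finset (DepVerify f Client Op)) : Prop :=
  ∃ M : Finset (Commit f Client Op), FromDistinct (2 * f + 1) Commit.sender M ∧
    ∀ m ∈ M, Msg.commit m ∈ sent ∧ m.slot = s ∧ m.view = w ∧ m.dv = dv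

def HasDepCommits (sent : Set (Msg f Client Op)) (s : Slot f)
    (dv : Finset (DepVerify f Client Op)) : Prop :=
  ∃ M : Finset (DepCommit f Client Op), FromDistinct (2 * f + 1) DepCommit.sender M ∧
    ∀ m ∈ M, Msg.depCommit m ∈ sent ∧ m.slot = s ∧ m.dv = dv

/-- The messages in `sent` justify the decision `x` for slot `s`. -/
def Justified (sent : Set (Msg f Client Op)) (s : Slot f) (x : Decision f Client Op) : Prop :=
  ∃ S : SlotState f Client Op, x = S.decision ∧ ValidPair sent s S.prop S.dv ∧
    ((S.prop ≠ none ∧ FastOK S.dv ∧ HasDepCommits sent s S.dv) ∨ ∃ w, HasCommits sent s w S.dv)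

section Monotone

variable {sent sent' : Set (Msg f Client Op)} (h : sent ⊆ sent')
include h

theorem Verified.mono {p : DepPropose f Client Op} {dv : Finset (DepVerify f Client Op)}
    (hv : Verified sent p dv) : Verified sent' p dv :=
  ⟨hv.1, fun m hm => ⟨h (hv.2 m hm).1, (hv.2 m hm).2⟩⟩

theorem ValidPair.mono {s : Slot f} {p : Option (DepPropose f Client Op)}
    {dv : Finset (DepVerify f Client Op)} (hv : ValidPair sent s p dv) : ValidPair sent' s p dv :=
  ⟨hv.1, fun q hq => ⟨(hv.2 q hq).1, h (hv.2 q hq).2.1, (hv.2 q hq).2.2.1,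
    (hv.2 q hq).2.2.2.mono h⟩⟩

theorem HasPrepares.mono {s : Slot f} {w : ℤ} {dv : Finset (DepVerify f Client Op)} :
    HasPrepares sent s w dv → HasPrepares sent' s w dv :=
  fun ⟨M, h1, h2⟩ => ⟨M, h1, fun m hm => ⟨h (h2 m hm).1, (h2 m hm).2⟩⟩

theorem HasCommits.mono {s : Slot f} {w : ℤ} {dv : Finset (DepVerify f Client Op)} :
    HasCommits sent s w dv → HasCommits sent' s w dv :=
  fun ⟨M, h1, h2⟩ => ⟨M, h1, fun m hm => ⟨h (h2 m hm).1, (h2 m hm).2⟩⟩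

theorem HasDepCommits.mono {s : Slot f} {dv : Finset (DepVerify f Client Op)} :
    HasDepCommits sent s dv → HasDepCommits sent' s dv :=
  fun ⟨M, h1, h2⟩ => ⟨M, h1, fun m hm => ⟨h (h2 m hm).1, (h2 m hm).2⟩⟩

theorem Justified.mono {s : Slot f} {x : Decision f Client Op} :
    Justified sent s x → Justified sent' s x := by
  rintro ⟨S, h1, h2, h3⟩
  refine ⟨S, h1, h2.mono h, ?_⟩
  rcases h3 with ⟨h4, h5, h6⟩ | ⟨w, h4⟩
  · exact Or.inl ⟨h4, h5, h6.mono h⟩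
  · exact Or.inr ⟨w, h4.mono h⟩

theorem Cert.Valid.mono {s : Slot f} {v : ℤ} {c : Cert f Client Op} (hc : c.Valid sent s v) :
    c.Valid sent' s v := by
  cases c with
  | none => trivial
  | fpc p dv =>
    obtain ⟨h1, h2, h3, h4, h5⟩ := hc
    exact ⟨h1, h h2, h3, h4.mono h, h5⟩
  | rpc p dv preps w =>
    obtain ⟨h1, h2, h3, h4, h5, h6⟩ := hc
    exact ⟨h1, h2, h3, fun q hq => ⟨(h4 q hq).1, h (h4 q hq).2.1, (h4 q hq).2.2.1,
      (h4 q hq).2.2.2.mono h⟩, h5, fun m hm => ⟨h (h6 m hm).1, (h6 m hm).2⟩⟩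

theorem NewView.Valid.mono {nv : NewView f Client Op} (hv : nv.Valid sent) : nv.Valid sent' :=
  ⟨hv.1, fun m hm => ⟨h (hv.2.1 m hm).1, (hv.2.1 m hm).2.1, (hv.2.1 m hm).2.2.1,
    (hv.2.1 m hm).2.2.2.mono h⟩, hv.2.2⟩

end Monotone

theorem NewView.Valid.validPair {sent : Set (Msg f Client Op)} {nv : NewView f Client Op}
    (hv : nv.Valid sent) : ValidPair sent nv.slot nv.prop nv.dv := by
  obtain ⟨-, h2, h3⟩ := hv
  rcases h3 with ⟨m, hm, preps, w, hc, -⟩ | ⟨-, m, hm, q, hq, hc⟩ | ⟨-, hp, hd⟩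
  · have := (h2 m hm).2.2.2
    rw [hc] at this
    exact ⟨this.2.2.1, this.2.2.2.1⟩
  · have := (h2 m hm).2.2.2
    rw [hc] at this
    obtain ⟨a, b, c, d, -⟩ := this
    rw [hq]
    exact ⟨fun h => by simp at h, fun p hp => by
      obtain rfl := Option.some.inj hp
      exact ⟨a, b, c, d⟩⟩
  · rw [hp]
    exact ⟨fun _ => hd, fun p hp => by simp at hp⟩

/-! ## The invariant of a slot at a correct replica -/

/-- The reconciliation-path certificate `c` has at least view `w`. -/
def Cert.RpcFrom (w : ℤ) (c : Cert f Client Op) : Prop :=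
  ∃ p dv preps w', c = .rpc p dv preps w' ∧ w ≤ w'

/-- `c` is a fast-path certificate with `dv`. -/
def Cert.IsFpc (dv : Finset (DepVerify f Client Op)) (c : Cert f Client Op) : Prop :=
  ∃ p, c = .fpc p dv

/-- The relation between the state `S` of slot `s` at the correct replica `i` and the messages
that `i` has sent for this slot. -/
structure SlotInv (sent : Set (Msg f Client Op)) (i : Replica f) (s : Slot f)
    (S : SlotState f Client Op) : Prop where
  view_ge : -1 ≤ S.view
  early : S.phase = .init ∨ S.phase = .proposed ∨ S.phase = .fpVerified ∨
    S.phase = .fpCommitted → S.view = -1 ∧ S.cert = .none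
  view_nonneg : S.phase = .viewChange → 0 ≤ S.view
  prop_valid : ∀ p, S.prop = some p → p.slot = s ∧ Msg.depPropose p ∈ sent ∧ ValidQuorum p
  fast : S.phase = .fpVerified ∨ S.phase = .fpCommitted →
    S.prop ≠ none ∧ ValidPair sent s S.prop S.dv ∧ FastOK S.dv
  recon : S.phase = .rpVerified ∨ S.phase = .rpPrepared ∨ S.phase = .rpCommitted →
    ValidPair sent s S.prop S.dv
  prepare_view : ∀ m : Prepare f Client Op, Msg.prepare m ∈ sent → m.sender = i → m.slot = s →
    -1 ≤ m.view ∧ m.view ≤ S.view ∧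
      (m.view = S.view → S.phase = .rpVerified ∨ S.phase = .rpPrepared ∨ S.phase = .rpCommitted)
  -- Only view -1 can be prepared without a NewView; this is what allows induction on views.
  prepare_newView : ∀ m : Prepare f Client Op, Msg.prepare m ∈ sent → m.sender = i → m.slot = s →
    0 ≤ m.view → ∃ nv : NewView f Client Op, nv.Valid sent ∧ nv.slot = s ∧ nv.view = m.view ∧
      nv.dv = m.dv
  prepare_unique : ∀ m m' : Prepare f Client Op, Msg.prepare m ∈ sent → m.sender = i → m.slot = s →
    Msg.prepare m' ∈ sent → m'.sender = i → m'.slot = s → m.view = m'.view → m.dv = m'.dv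
  -- The trace of a DepCommit survives view changes: the fast-path certificate is kept until a
  -- reconciliation certificate replaces it. That one has view at least 0, as a replica that sent a
  -- DepCommit sends no Prepare in view -1.
  depCommit_state : ∀ m : DepCommit f Client Op, Msg.depCommit m ∈ sent → m.sender = i →
    m.slot = s → ((S.phase = .fpVerified ∨ S.phase = .fpCommitted) ∧ S.dv = m.dv) ∨
      (0 ≤ S.view ∧ (S.phase = .rpPrepared ∨ S.phase = .rpCommitted ∨ S.cert.IsFpc m.dv ∨
        S.cert.RpcFrom 0))
  depCommit_unique : ∀ m m' : DepCommit f Client Op, Msg.depCommit m ∈ sent → m.sender = i →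
    m.slot = s → Msg.depCommit m' ∈ sent → m'.sender = i → m'.slot = s → m.dv = m'.dv
  depCommit_prepare : ∀ (m : DepCommit f Client Op) (m' : Prepare f Client Op),
    Msg.depCommit m ∈ sent → m.sender = i → m.slot = s →
    Msg.prepare m' ∈ sent → m'.sender = i → m'.slot = s → 0 ≤ m'.view
  depCommit_viewChange : ∀ (m : DepCommit f Client Op) (m' : ViewChange f Client Op),
    Msg.depCommit m ∈ sent → m.sender = i → m.slot = s →
    Msg.viewChange m' ∈ sent → m'.sender = i → m'.slot = s →
    m'.cert.IsFpc m.dv ∨ m'.cert.RpcFrom 0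
  -- A follower that has verified a proposal sends DepCommit only for that proposal. This later
  -- identifies the proposal of a foreign fast-path certificate.
  depCommit_depVerify : ∀ (m : DepCommit f Client Op) (m' : DepVerify f Client Op),
    Msg.depCommit m ∈ sent → m.sender = i → m.slot = s →
    Msg.depVerify m' ∈ sent → m'.sender = i → m'.prop.slot = s → Verified sent m'.prop m.dv
  -- The reported certificate is always the newest one, so its view never falls below that of a
  -- Commit already sent.
  commit_state : ∀ m : Commit f Client Op, Msg.commit m ∈ sent → m.sender = i → m.slot = s →
    m.view ≤ S.view ∧ (S.phase = .rpPrepared ∨ S.phase = .rpCommitted ∨ S.cert.RpcFrom m.view)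
  commit_prepares : ∀ m : Commit f Client Op, Msg.commit m ∈ sent → m.sender = i → m.slot = s →
    -1 ≤ m.view ∧ HasPrepares sent s m.view m.dv
  commit_viewChange : ∀ (m : Commit f Client Op) (m' : ViewChange f Client Op),
    Msg.commit m ∈ sent → m.sender = i → m.slot = s →
    Msg.viewChange m' ∈ sent → m'.sender = i → m'.slot = s → m.view < m'.view →
    m'.cert.RpcFrom m.view
  viewChange_view : ∀ m : ViewChange f Client Op, Msg.viewChange m ∈ sent → m.sender = i →
    m.slot = s → 0 ≤ m.view ∧ m.view ≤ S.view
  depVerify_state : ∀ m : DepVerify f Client Op, Msg.depVerify m ∈ sent → m.sender = i →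
    m.prop.slot = s → S.phase ≠ .init ∧ Msg.depPropose m.prop ∈ sent ∧ s.coord ≠ i ∧
      (S.phase = .proposed → S.prop = some m.prop)
  depVerify_unique : ∀ m m' : DepVerify f Client Op, Msg.depVerify m ∈ sent → m.sender = i →
    m.prop.slot = s → Msg.depVerify m' ∈ sent → m'.sender = i → m'.prop.slot = s → m = m'
  depPropose_state : ∀ p : DepPropose f Client Op, Msg.depPropose p ∈ sent → p.slot = s →
    s.coord = i → S.phase ≠ .init
  depPropose_unique : ∀ p p' : DepPropose f Client Op, Msg.depPropose p ∈ sent → p.slot = s →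
    Msg.depPropose p' ∈ sent → p'.slot = s → s.coord = i → p = p'
  exec_state : ∀ x, S.exec = some x → Justified sent s x
  exec_sent : ∀ m : Exec f Client Op, Msg.exec m ∈ sent → m.sender = i → m.slot = s →
    Justified sent s m.decision

theorem SlotInv.initial (i : Replica f) (s : Slot f) :
    SlotInv (∅ : Set (Msg f Client Op)) i s ⟨none, .init, -1, ∅, .none, none⟩ := by
  constructor <;> simp

/-- The invariant does not depend on messages of other replicas and for other slots. -/
theorem SlotInv.frame {sent sent' : Set (Msg f Client Op)} {i : Replica f} {s : Slot f}
    {S : SlotState f Client Op} (h : SlotInv sent i s S) (hsub : sent ⊆ sent')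
    (hnew : ∀ m ∈ sent', m.signer = i → m.slot = s → m ∈ sent) : SlotInv sent' i s S := by
  have e1 : ∀ m : Prepare f Client Op, Msg.prepare m ∈ sent' → m.sender = i → m.slot = s →
    Msg.prepare m ∈ sent := fun m => hnew (.prepare m)
  have e2 : ∀ m : DepCommit f Client Op, Msg.depCommit m ∈ sent' → m.sender = i → m.slot = s →
    Msg.depCommit m ∈ sent := fun m => hnew (.depCommit m)
  have e3 : ∀ m : Commit f Client Op, Msg.commit m ∈ sent' → m.sender = i → m.slot = s →
    Msg.commit m ∈ sent := fun m => hnew (.commit m)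
  have e4 : ∀ m : ViewChange f Client Op, Msg.viewChange m ∈ sent' → m.sender = i → m.slot = s →
    Msg.viewChange m ∈ sent := fun m => hnew (.viewChange m)
  have e5 : ∀ m : DepVerify f Client Op, Msg.depVerify m ∈ sent' → m.sender = i →
    m.prop.slot = s → Msg.depVerify m ∈ sent := fun m => hnew (.depVerify m)
  have e6 : ∀ m : Exec f Client Op, Msg.exec m ∈ sent' → m.sender = i → m.slot = s →
    Msg.exec m ∈ sent := fun m => hnew (.exec m)
  -- A DepPropose has no sender field; it is signed by the coordinator of its slot, whence the
  -- condition `s.coord = i`.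
  have e7 : ∀ p : DepPropose f Client Op, Msg.depPropose p ∈ sent' → p.slot = s → s.coord = i →
    Msg.depPropose p ∈ sent := fun p h1 h2 h3 => hnew (.depPropose p) h1 (by rw [← h3, ← h2]; rfl) h2
  exact
  { view_ge := h.view_ge
    early := h.early
    view_nonneg := h.view_nonneg
    prop_valid := fun p hp => ⟨(h.prop_valid p hp).1, hsub (h.prop_valid p hp).2.1,
      (h.prop_valid p hp).2.2⟩
    fast := fun hf => ⟨(h.fast hf).1, (h.fast hf).2.1.mono hsub, (h.fast hf).2.2⟩
    recon := fun hr => (h.recon hr).mono hsub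
    prepare_view := fun m a b c => h.prepare_view m (e1 m a b c) b c
    prepare_newView := fun m a b c d =>
      let ⟨nv, hv, r⟩ := h.prepare_newView m (e1 m a b c) b c d
      ⟨nv, hv.mono hsub, r⟩
    prepare_unique := fun m m' a b c a' b' c' =>
      h.prepare_unique m m' (e1 m a b c) b c (e1 m' a' b' c') b' c'
    depCommit_state := fun m a b c => h.depCommit_state m (e2 m a b c) b c
    depCommit_unique := fun m m' a b c a' b' c' =>
      h.depCommit_unique m m' (e2 m a b c) b c (e2 m' a' b' c') b' c'
    depCommit_prepare := fun m m' a b c a' b' c' =>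
      h.depCommit_prepare m m' (e2 m a b c) b c (e1 m' a' b' c') b' c'
    depCommit_viewChange := fun m m' a b c a' b' c' =>
      h.depCommit_viewChange m m' (e2 m a b c) b c (e4 m' a' b' c') b' c'
    depCommit_depVerify := fun m m' a b c a' b' c' =>
      (h.depCommit_depVerify m m' (e2 m a b c) b c (e5 m' a' b' c') b' c').mono hsub
    commit_state := fun m a b c => h.commit_state m (e3 m a b c) b c
    commit_prepares := fun m a b c => ⟨(h.commit_prepares m (e3 m a b c) b c).1,
      (h.commit_prepares m (e3 m a b c) b c).2.mono hsub⟩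
    commit_viewChange := fun m m' a b c a' b' c' =>
      h.commit_viewChange m m' (e3 m a b c) b c (e4 m' a' b' c') b' c'
    viewChange_view := fun m a b c => h.viewChange_view m (e4 m a b c) b c
    depVerify_state := fun m a b c =>
      let ⟨r1, r2, r3⟩ := h.depVerify_state m (e5 m a b c) b c
      ⟨r1, hsub r2, r3⟩
    depVerify_unique := fun m m' a b c a' b' c' =>
      h.depVerify_unique m m' (e5 m a b c) b c (e5 m' a' b' c') b' c'
    depPropose_state := fun p a b c => h.depPropose_state p (e7 p a b c) b c
    depPropose_unique := fun p p' a b a' b' c =>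
      h.depPropose_unique p p' (e7 p a b c) b (e7 p' a' b' c) b' c
    exec_state := fun x hx => (h.exec_state x hx).mono hsub
    exec_sent := fun m a b c => (h.exec_sent m (e6 m a b c) b c).mono hsub }

/-! ## Preservation of the invariant by the transitions of a slot -/

section Transitions

set_option linter.unusedSimpArgs false

variable {sent sent' : Set (Msg f Client Op)} {i : Replica f}
  {s : Slot f} {S : SlotState f Client Op}

/-- The pattern of all transition lemmas: monotonicity facts and the clauses of the old invariant
are put into the context, and each new clause is a case distinction on whether its messages are old
or the one just sent. Here `hphase` shows that nothing was proposed for the slot before. -/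
theorem SlotInv.propose {p : DepPropose f Client Op} (h : SlotInv sent i s S)
    (hp : p.slot = s) (hi : s.coord = i) (hphase : S.phase = .init) (hq : ValidQuorum p)
    (hm : ∀ m, m ∈ sent' ↔ m ∈ sent ∨ m = .depPropose p) :
    SlotInv sent' i s { S with prop := some p, phase := .proposed } := by
  have hs : sent ⊆ sent' := fun m h => (hm m).2 (Or.inl h)
  have j1 := fun s x => @Justified.mono f Client Op _ _ hs s x
  have j2 := fun p dv => @Verified.mono f Client Op _ _ hs p dv
  have j3 := fun s w dv => @HasPrepares.mono f Client Op _ _ hs s w dv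
  have j4 := fun nv => @NewView.Valid.mono f Client Op _ _ hs nv
  have j5 := fun s p dv => @ValidPair.mono f Client Op _ _ hs s p dv
  obtain ⟨h1, h2, h3, h4, h5, h6, h7, h8, h9, h10, h11, h12, h13, h14, h15, h16, h17, h18, h19,
    h20, h21, h22, h23, h24⟩ := h
  constructor <;> try simp only [hm, reduceCtorEq, false_or, or_false, false_and, and_false, Msg.depPropose.injEq]
  all_goals first | assumption | grind

theorem SlotInv.setProp {p : DepPropose f Client Op} (h : SlotInv sent i s S)
    (hp : p.slot = s) (hsent : Msg.depPropose p ∈ sent) (hq : ValidQuorum p) (hphase : S.phase = .init) :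
    SlotInv sent i s { S with prop := some p } := by
  obtain ⟨h1, h2, h3, h4, h5, h6, h7, h8, h9, h10, h11, h12, h13, h14, h15, h16, h17, h18, h19,
    h20, h21, h22, h23, h24⟩ := h
  constructor <;> try simp only [reduceCtorEq, false_or, or_false, false_and, and_false]
  all_goals first | assumption | grind

/-- `P` stands for membership in the fast-path quorum, so that accepting with and without a
DepVerify is one transition. A DepVerify forces the phase out of `init`, and no transition leads
back, hence there is at most one per slot. -/
theorem SlotInv.accept {p : DepPropose f Client Op} {D : Finset (Slot f)} {P : Prop} (h : SlotInv sent i s S)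
    (hp : p.slot = s) (hsent : Msg.depPropose p ∈ sent) (hq : ValidQuorum p) (hi : s.coord ≠ i)
    (hphase : S.phase = .init)
    (hm : ∀ m, m ∈ sent' ↔ m ∈ sent ∨ P ∧ m = .depVerify ⟨i, p, D⟩) :
    SlotInv sent' i s { S with prop := some p, phase := .proposed } := by
  have hs : sent ⊆ sent' := fun m h => (hm m).2 (Or.inl h)
  have j1 := fun s x => @Justified.mono f Client Op _ _ hs s x
  have j2 := fun p dv => @Verified.mono f Client Op _ _ hs p dv
  have j3 := fun s w dv => @HasPrepares.mono f Client Op _ _ hs s w dv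
  have j4 := fun nv => @NewView.Valid.mono f Client Op _ _ hs nv
  have j5 := fun s p dv => @ValidPair.mono f Client Op _ _ hs s p dv
  obtain ⟨h1, h2, h3, h4, h5, h6, h7, h8, h9, h10, h11, h12, h13, h14, h15, h16, h17, h18, h19,
    h20, h21, h22, h23, h24⟩ := h
  constructor <;> try simp only [hm, reduceCtorEq, false_or, or_false, false_and, and_false, Msg.depVerify.injEq]
  all_goals first | assumption | grind

theorem SlotInv.fpVerify {p : DepPropose f Client Op} {dv : Finset (DepVerify f Client Op)} (h : SlotInv sent i s S)
    (hphase : S.phase = .proposed) (hprop : S.prop = some p) (hdv : Verified sent p dv)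
    (hfast : FastOK dv)
    (hm : ∀ m, m ∈ sent' ↔ m ∈ sent ∨ m = .depCommit ⟨s, i, dv⟩) :
    SlotInv sent' i s { S with dv := dv, phase := .fpVerified } := by
  have hs : sent ⊆ sent' := fun m h => (hm m).2 (Or.inl h)
  have j1 := fun s x => @Justified.mono f Client Op _ _ hs s x
  have j2 := fun p dv => @Verified.mono f Client Op _ _ hs p dv
  have j3 := fun s w dv => @HasPrepares.mono f Client Op _ _ hs s w dv
  have j4 := fun nv => @NewView.Valid.mono f Client Op _ _ hs nv
  have j5 := fun s p dv => @ValidPair.mono f Client Op _ _ hs s p dv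
  have hpair : ValidPair sent' s S.prop dv := ⟨by simp [hprop], fun q hq => by
    obtain rfl : p = q := by simpa [hprop] using hq
    have := h.prop_valid p hprop
    exact ⟨this.1, hs this.2.1, this.2.2, hdv.mono hs⟩⟩
  obtain ⟨h1, h2, h3, h4, h5, h6, h7, h8, h9, h10, h11, h12, h13, h14, h15, h16, h17, h18, h19,
    h20, h21, h22, h23, h24⟩ := h
  constructor <;> try simp only [hm, reduceCtorEq, false_or, or_false, false_and, and_false, Msg.depCommit.injEq]
  all_goals first | assumption | grind

theorem SlotInv.rpVerify {p : DepPropose f Client Op} {dv : Finset (DepVerify f Client Op)} (h : SlotInv sent i s S)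
    (hphase : S.phase = .proposed) (hprop : S.prop = some p) (hdv : Verified sent p dv)
    (hm : ∀ m, m ∈ sent' ↔ m ∈ sent ∨ m = .prepare ⟨S.view, s, i, dv⟩) :
    SlotInv sent' i s { S with dv := dv, phase := .rpVerified } := by
  have hs : sent ⊆ sent' := fun m h => (hm m).2 (Or.inl h)
  have j1 := fun s x => @Justified.mono f Client Op _ _ hs s x
  have j2 := fun p dv => @Verified.mono f Client Op _ _ hs p dv
  have j3 := fun s w dv => @HasPrepares.mono f Client Op _ _ hs s w dv
  have j4 := fun nv => @NewView.Valid.mono f Client Op _ _ hs nv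
  have j5 := fun s p dv => @ValidPair.mono f Client Op _ _ hs s p dv
  have hpair : ValidPair sent' s S.prop dv := ⟨by simp [hprop], fun q hq => by
    obtain rfl : p = q := by simpa [hprop] using hq
    have := h.prop_valid p hprop
    exact ⟨this.1, hs this.2.1, this.2.2, hdv.mono hs⟩⟩
  obtain ⟨h1, h2, h3, h4, h5, h6, h7, h8, h9, h10, h11, h12, h13, h14, h15, h16, h17, h18, h19,
    h20, h21, h22, h23, h24⟩ := h
  constructor <;> try simp only [hm, reduceCtorEq, false_or, or_false, false_and, and_false, Msg.prepare.injEq]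
  all_goals first | assumption | grind

theorem SlotInv.fpCommit (h : SlotInv sent i s S)
    (hphase : S.phase = .fpVerified) (hM : HasDepCommits sent s S.dv) :
    SlotInv sent i s { S.decide with phase := .fpCommitted } := by
  -- `SlotState.decide` keeps an earlier decision, so the quorum is needed only if there is none
  -- yet.
  have hx : ∀ x, S.decide.exec = some x → Justified sent s x := by
    intro x hx
    cases he : S.exec with
    | some y => exact h.exec_state x (by simpa [SlotState.decide, he] using hx)
    | none =>
      obtain rfl : S.decision = x := by simpa [SlotState.decide, he] using hx
      have := h.fast (Or.inl hphase)
      exact ⟨S, rfl, this.2.1, Or.inl ⟨this.1, this.2.2, hM⟩⟩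
  have hd : S.decide.prop = S.prop ∧ S.decide.view = S.view ∧ S.decide.dv = S.dv ∧
    S.decide.cert = S.cert := ⟨rfl, rfl, rfl, rfl⟩
  obtain ⟨h1, h2, h3, h4, h5, h6, h7, h8, h9, h10, h11, h12, h13, h14, h15, h16, h17, h18, h19,
    h20, h21, h22, h23, h24⟩ := h
  constructor <;> try simp only [reduceCtorEq, false_or, or_false, false_and, and_false]
  all_goals first | assumption | grind

theorem SlotInv.rpPrepare (h : SlotInv sent i s S)
    (hphase : S.phase = .rpVerified) (hM : HasPrepares sent s S.view S.dv)
    (hm : ∀ m, m ∈ sent' ↔ m ∈ sent ∨ m = .commit ⟨S.view, s, i, S.dv⟩) :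
    SlotInv sent' i s { S with phase := .rpPrepared } := by
  have hs : sent ⊆ sent' := fun m h => (hm m).2 (Or.inl h)
  have j1 := fun s x => @Justified.mono f Client Op _ _ hs s x
  have j2 := fun p dv => @Verified.mono f Client Op _ _ hs p dv
  have j3 := fun s w dv => @HasPrepares.mono f Client Op _ _ hs s w dv
  have j4 := fun nv => @NewView.Valid.mono f Client Op _ _ hs nv
  have j5 := fun s p dv => @ValidPair.mono f Client Op _ _ hs s p dv
  obtain ⟨h1, h2, h3, h4, h5, h6, h7, h8, h9, h10, h11, h12, h13, h14, h15, h16, h17, h18, h19,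
    h20, h21, h22, h23, h24⟩ := h
  constructor <;> try simp only [hm, reduceCtorEq, false_or, or_false, false_and, and_false, Msg.commit.injEq]
  all_goals first | assumption | grind

theorem SlotInv.rpCommit (h : SlotInv sent i s S)
    (hphase : S.phase = .rpPrepared) (hM : HasCommits sent s S.view S.dv) :
    SlotInv sent i s { S.decide with phase := .rpCommitted } := by
  have hx : ∀ x, S.decide.exec = some x → Justified sent s x := by
    intro x hx
    cases he : S.exec with
    | some y => exact h.exec_state x (by simpa [SlotState.decide, he] using hx)
    | none =>
      obtain rfl : S.decision = x := by simpa [SlotState.decide, he] using hx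
      exact ⟨S, rfl, h.recon (Or.inr (Or.inl hphase)), Or.inr ⟨_, hM⟩⟩
  have hd : S.decide.prop = S.prop ∧ S.decide.view = S.view ∧ S.decide.dv = S.dv ∧
    S.decide.cert = S.cert := ⟨rfl, rfl, rfl, rfl⟩
  obtain ⟨h1, h2, h3, h4, h5, h6, h7, h8, h9, h10, h11, h12, h13, h14, h15, h16, h17, h18, h19,
    h20, h21, h22, h23, h24⟩ := h
  constructor <;> try simp only [reduceCtorEq, false_or, or_false, false_and, and_false]
  all_goals first | assumption | grind

/-- The one transition where commitments must be handed over from the phase to the certificate. A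
replica that leaves a view unprepared repeats its old certificate, so nothing is lost by passing
through several views. -/
theorem SlotInv.viewChange {v : ℤ} {c : Cert f Client Op} (h : SlotInv sent i s S)
    (hv : S.view < v) (hc : S.NewestCert sent s c)
    (hm : ∀ m, m ∈ sent' ↔ m ∈ sent ∨ m = .viewChange ⟨v, s, i, c⟩) :
    SlotInv sent' i s { S with view := v, phase := .viewChange, cert := c } := by
  have hs : sent ⊆ sent' := fun m h => (hm m).2 (Or.inl h)
  have j1 := fun s x => @Justified.mono f Client Op _ _ hs s x
  have j2 := fun p dv => @Verified.mono f Client Op _ _ hs p dv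
  have j3 := fun s w dv => @HasPrepares.mono f Client Op _ _ hs s w dv
  have j4 := fun nv => @NewView.Valid.mono f Client Op _ _ hs nv
  have j5 := fun s p dv => @ValidPair.mono f Client Op _ _ hs s p dv
  have hc1 : S.phase = .fpVerified ∨ S.phase = .fpCommitted → c.IsFpc S.dv := by
    intro hp
    rcases hp with hp | hp <;> simp only [SlotState.NewestCert, hp] at hc <;>
      obtain ⟨p, -, rfl⟩ := hc <;> exact ⟨p, rfl⟩
  have hc2 : S.phase = .rpPrepared ∨ S.phase = .rpCommitted → ∀ w, w ≤ S.view → c.RpcFrom w := by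
    intro hp
    rcases hp with hp | hp <;> simp only [SlotState.NewestCert, hp] at hc <;>
      obtain ⟨M, -, -, rfl⟩ := hc <;> exact fun w hw => ⟨_, _, _, _, rfl, hw⟩
  have hc3 : S.phase = .init ∨ S.phase = .proposed ∨ S.phase = .rpVerified ∨
      S.phase = .viewChange → c = S.cert := by
    intro hp
    rcases hp with hp | hp | hp | hp <;> simpa only [SlotState.NewestCert, hp] using hc
  have hph : ∀ P : Phase, (P = .init ∨ P = .proposed ∨ P = .rpVerified ∨ P = .viewChange) ∨
      (P = .fpVerified ∨ P = .fpCommitted) ∨ P = .rpPrepared ∨ P = .rpCommitted := by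
    intro P; cases P <;> simp
  -- The new certificate reflects every DepCommit sent before, and by `hk2` every Commit. The phases
  -- split into those that keep the old certificate, the fast-path phases, and the prepared phases.
  have hk1 : ∀ m : DepCommit f Client Op, Msg.depCommit m ∈ sent → m.sender = i → m.slot = s →
      c.IsFpc m.dv ∨ c.RpcFrom 0 := by
    intro m a b d
    have := h.depCommit_state m a b d
    rcases hph S.phase with hp | hp | hp
    · rw [hc3 hp]
      have := h.early
      grind
    · have := hc1 hp
      have := h.early
      grind
    · refine Or.inr (hc2 hp 0 ?_)
      grind
  have hk2 : ∀ m : Commit f Client Op, Msg.commit m ∈ sent → m.sender = i → m.slot = s →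
      c.RpcFrom m.view := by
    intro m a b d
    have := h.commit_state m a b d
    have hnone : ∀ w, ¬ (Cert.none : Cert f Client Op).RpcFrom w := by
      rintro w ⟨_, _, _, _, h, -⟩; cases h
    rcases hph S.phase with hp | hp | hp
    · rw [hc3 hp]
      grind
    · have := h.early
      grind
    · exact hc2 hp _ this.1
  clear hc1 hc2 hc3 hph hc
  obtain ⟨h1, h2, h3, h4, h5, h6, h7, h8, h9, h10, h11, h12, h13, h14, h15, h16, h17, h18, h19,
    h20, h21, h22, h23, h24⟩ := h
  constructor <;> try simp only [hm, reduceCtorEq, false_or, or_false, false_and, and_false, Msg.viewChange.injEq]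
  all_goals first | assumption | grind

/-- `P` tells the view-change coordinator, which also sends the NewView, from a replica that follows
it. In phase `viewChange` no Prepare of the current view has been sent, so the new one is unique for
its view. -/
theorem SlotInv.enter {nv : NewView f Client Op} {P : Prop} (h : SlotInv sent i s S)
    (hslot : nv.slot = s) (hphase : S.phase = .viewChange) (hview : S.view = nv.view)
    (hvalid : nv.Valid sent)
    (hm : ∀ m, m ∈ sent' ↔ m ∈ sent ∨ m = .prepare ⟨nv.view, s, i, nv.dv⟩ ∨ P ∧ m = .newView nv) :
    SlotInv sent' i s { S with prop := nv.prop, dv := nv.dv, phase := .rpVerified } := by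
  have hs : sent ⊆ sent' := fun m h => (hm m).2 (Or.inl h)
  have j1 := fun s x => @Justified.mono f Client Op _ _ hs s x
  have j2 := fun p dv => @Verified.mono f Client Op _ _ hs p dv
  have j3 := fun s w dv => @HasPrepares.mono f Client Op _ _ hs s w dv
  have j4 := fun nv => @NewView.Valid.mono f Client Op _ _ hs nv
  have j5 := fun s p dv => @ValidPair.mono f Client Op _ _ hs s p dv
  have hpair : ValidPair sent' s nv.prop nv.dv := hslot ▸ hvalid.validPair.mono hs
  have hpp : ∀ p, nv.prop = some p → p.slot = s ∧ Msg.depPropose p ∈ sent' ∧ ValidQuorum p :=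
    fun p hp => ⟨(hpair.2 p hp).1, (hpair.2 p hp).2.1, (hpair.2 p hp).2.2.1⟩
  obtain ⟨h1, h2, h3, h4, h5, h6, h7, h8, h9, h10, h11, h12, h13, h14, h15, h16, h17, h18, h19,
    h20, h21, h22, h23, h24⟩ := h
  constructor <;> try simp only [hm, reduceCtorEq, false_or, or_false, false_and, and_false, Msg.prepare.injEq]
  all_goals first | assumption | grind

theorem SlotInv.sendExec {x : Decision f Client Op} (h : SlotInv sent i s S)
    (hx : S.exec = some x)
    (hm : ∀ m, m ∈ sent' ↔ m ∈ sent ∨ m = .exec ⟨s, i, x⟩) :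
    SlotInv sent' i s S := by
  have hs : sent ⊆ sent' := fun m h => (hm m).2 (Or.inl h)
  have j1 := fun s x => @Justified.mono f Client Op _ _ hs s x
  have j2 := fun p dv => @Verified.mono f Client Op _ _ hs p dv
  have j3 := fun s w dv => @HasPrepares.mono f Client Op _ _ hs s w dv
  have j4 := fun nv => @NewView.Valid.mono f Client Op _ _ hs nv
  have j5 := fun s p dv => @ValidPair.mono f Client Op _ _ hs s p dv
  obtain ⟨h1, h2, h3, h4, h5, h6, h7, h8, h9, h10, h11, h12, h13, h14, h15, h16, h17, h18, h19,
    h20, h21, h22, h23, h24⟩ := h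
  constructor <;> try simp only [hm, reduceCtorEq, false_or, or_false, false_and, and_false, Msg.exec.injEq]
  all_goals first | assumption | grind

theorem SlotInv.learnExec {x : Decision f Client Op} (h : SlotInv sent i s S)
    (hx : Justified sent s x) :
    SlotInv sent i s { S with exec := some x } := by
  obtain ⟨h1, h2, h3, h4, h5, h6, h7, h8, h9, h10, h11, h12, h13, h14, h15, h16, h17, h18, h19,
    h20, h21, h22, h23, h24⟩ := h
  constructor <;> try simp only [reduceCtorEq, false_or, or_false, false_and, and_false]
  all_goals first | assumption | grind

end Transitions

/-! ## Quorums -/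

open Classical in
theorem FromDistinct.card_image {M : Type*} {n : ℕ} {sender : M → Replica f} {A : Finset M}
    (h : FromDistinct n sender A) : (A.image sender).card = n := by
  rw [Finset.card_image_of_injOn, h.1]
  exact fun x hx y hy hxy => h.2 x hx y hy hxy

theorem FromDistinct.exists_correct {M : Type*} {n : ℕ} {sender : M → Replica f} {A : Finset M}
    (h : FromDistinct n sender A) {faulty : Finset (Replica f)} (hn : faulty.card < n) :
    ∃ x ∈ A, sender x ∉ faulty := by
  classical
  by_contra hcon
  push Not at hcon
  have : A.image sender ⊆ faulty := fun y hy => by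
    obtain ⟨x, hx, rfl⟩ := Finset.mem_image.1 hy
    exact hcon x hx
  have := Finset.card_le_card this
  rw [h.card_image] at this
  omega

/-- Two quorums of `2 * f + 1` replicas have a correct replica in common. -/
theorem exists_correct_of_quorums {faulty A B : Finset (Replica f)} (hfaulty : faulty.card ≤ f)
    (hA : A.card = 2 * f + 1) (hB : B.card = 2 * f + 1) : ∃ i ∉ faulty, i ∈ A ∧ i ∈ B := by
  classical
  have h1 := Finset.card_union_add_card_inter A B
  have h2 : (A ∪ B).card ≤ 3 * f + 1 := by simpa using Finset.card_le_univ (A ∪ B)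
  -- The intersection has at least 2(2f+1) - (3f+1) = f+1 members.
  obtain ⟨i, hi, hif⟩ := Finset.exists_mem_notMem_of_card_lt_card (s := faulty) (t := A ∩ B)
    (by omega)
  exact ⟨i, hif, Finset.mem_inter.1 hi⟩

theorem FromDistinct.exists_common {M M' : Type*} {sender : M → Replica f}
    {sender' : M' → Replica f} {A : Finset M} {B : Finset M'} {faulty : Finset (Replica f)}
    (hfaulty : faulty.card ≤ f) (hA : FromDistinct (2 * f + 1) sender A)
    (hB : FromDistinct (2 * f + 1) sender' B) :
    ∃ x ∈ A, ∃ y ∈ B, sender x ∉ faulty ∧ sender' y = sender x := by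
  classical
  obtain ⟨i, hi, h1, h2⟩ := exists_correct_of_quorums hfaulty hA.card_image hB.card_image
  obtain ⟨x, hx, rfl⟩ := Finset.mem_image.1 h1
  obtain ⟨y, hy, hyx⟩ := Finset.mem_image.1 h2
  exact ⟨x, hx, y, hy, hi, hyx⟩

/-! ## The invariant along a run -/

/-- The slot invariant holds for all slots of all correct replicas. -/
def Config.Inv (faulty : Finset (Replica f)) (c : Config f Client Op) : Prop :=
  ∀ i ∉ faulty, ∀ s, SlotInv c.sent i s ((c.loc i).slots s)

theorem Local.enter_slots (L : Local f Client Op) (nv : NewView f Client Op) :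
    (L.enter nv).slots = (L.setSlot nv.slot
      { L.slots nv.slot with prop := nv.prop, dv := nv.dv, phase := .rpVerified }).slots := by
  unfold Local.enter
  split <;> rfl

theorem Local.setSlot_same (L : Local f Client Op) (s : Slot f) (S : SlotState f Client Op) :
    (L.setSlot s S).slots s = S := by
  simp [Local.setSlot]

theorem Local.setSlot_ne (L : Local f Client Op) {s s' : Slot f} (S : SlotState f Client Op)
    (h : s' ≠ s) : (L.setSlot s S).slots s' = L.slots s' := by
  simp [Local.setSlot, h]

theorem SlotInv.setSlot {sent out : Set (Msg f Client Op)} {i : Replica f}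
    {L : Local f Client Op} (h : ∀ s, SlotInv sent i s (L.slots s)) {s : Slot f}
    {S : SlotState f Client Op} (hout : ∀ m ∈ out, m.slot = s)
    (hS : SlotInv (sent ∪ out) i s S) (s' : Slot f) :
    SlotInv (sent ∪ out) i s' ((L.setSlot s S).slots s') := by
  by_cases hs : s' = s
  · subst hs
    rwa [Local.setSlot_same]
  · rw [Local.setSlot_ne _ _ hs]
    refine (h s').frame Set.subset_union_left ?_
    rintro m (hm | hm) - hms
    · exact hm
    · exact absurd (hms.symm.trans (hout m hm)) hs

theorem LocalStep.signer_eq {conf : Request Client Op → Request Client Op → Prop} {k : ℕ}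
    {issued : Set (Request Client Op)} {sent out : Set (Msg f Client Op)} {i : Replica f}
    {L L' : Local f Client Op} (h : LocalStep conf k issued sent i L L' out) :
    ∀ m ∈ out, m.signer = i := by
  cases h with
  | propose p hslot => rintro m rfl; simp [Msg.signer, hslot]
  | accept p => rintro m ⟨-, rfl⟩; rfl
  | sendNewView nv hcoord => rintro m (rfl | rfl); exacts [hcoord, rfl]
  | _ => first | (rintro m rfl; rfl) | simp

/-- `hexec` is what `learnExec` needs beyond the invariant of the replica itself: a decision taken
over from f+1 reports is justified by messages. -/
theorem LocalStep.slotInv {conf : Request Client Op → Request Client Op → Prop} {k : ℕ}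
    {issued : Set (Request Client Op)} {sent out : Set (Msg f Client Op)} {i : Replica f}
    {L L' : Local f Client Op} (h : LocalStep conf k issued sent i L L' out)
    (hinv : ∀ s, SlotInv sent i s (L.slots s))
    (hexec : ∀ M : Finset (Exec f Client Op), FromDistinct (f + 1) Exec.sender M →
      (∀ m ∈ M, Msg.exec m ∈ sent) → ∃ m ∈ M, Justified sent m.slot m.decision) :
    ∀ s, SlotInv (sent ∪ out) i s (L'.slots s) := by
  cases h with
  | propose p hslot hphase _ _ hq =>
    refine SlotInv.setSlot (L := L) hinv (by rintro m rfl; rfl) ?_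
    exact (hinv p.slot).propose rfl (by simp [hslot]) hphase hq fun m => Iff.rfl
  | acceptHeader p hp =>
    refine SlotInv.setSlot (L := L) hinv (by simp) ?_
    rw [Set.union_empty]
    exact (hinv p.slot).setProp rfl hp.1 hp.2.2.1 hp.2.2.2.1
  | accept p hp =>
    refine SlotInv.setSlot (L := L) hinv (by rintro m ⟨-, rfl⟩; rfl) ?_
    exact (hinv p.slot).accept rfl hp.1 hp.2.2.1 hp.2.1 hp.2.2.2.1 fun m => Iff.rfl
  | fpVerify p dv hphase hprop hdv _ hfast =>
    refine SlotInv.setSlot (L := L) hinv (by rintro m rfl; rfl) ?_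
    exact (hinv p.slot).fpVerify hphase hprop hdv hfast fun m => Iff.rfl
  | rpVerify p dv hphase hprop hdv =>
    refine SlotInv.setSlot (L := L) hinv (by rintro m rfl; rfl) ?_
    exact (hinv p.slot).rpVerify hphase hprop hdv fun m => Iff.rfl
  | fpCommit s M hphase hM hmatch =>
    refine SlotInv.setSlot (L := L) hinv (by simp) ?_
    rw [Set.union_empty]
    exact (hinv s).fpCommit hphase ⟨M, hM, hmatch⟩
  | rpPrepare s M hphase hM hmatch =>
    refine SlotInv.setSlot (L := L) hinv (by rintro m rfl; rfl) ?_
    exact (hinv s).rpPrepare hphase ⟨M, hM, hmatch⟩ fun m => Iff.rfl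
  | rpCommit s M hphase hM hmatch =>
    refine SlotInv.setSlot (L := L) hinv (by simp) ?_
    rw [Set.union_empty]
    exact (hinv s).rpCommit hphase ⟨M, hM, hmatch⟩
  | viewChange s v c htrigger hc =>
    refine SlotInv.setSlot (L := L) hinv (by rintro m rfl; rfl) ?_
    refine (hinv s).viewChange ?_ hc fun m => Iff.rfl
    rcases htrigger with ⟨-, rfl⟩ | ⟨h, -⟩
    · exact lt_add_one _
    · exact h
  | sendNewView nv hcoord hphase hview hvalid =>
    rw [Local.enter_slots]
    refine SlotInv.setSlot (L := L) hinv (by rintro m (rfl | rfl) <;> rfl) ?_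
    exact (hinv nv.slot).enter (P := True) rfl hphase hview hvalid fun m => by
      simp [or_comm, or_left_comm]
  | acceptNewView nv hsent hphase hview hvalid =>
    rw [Local.enter_slots]
    refine SlotInv.setSlot (L := L) hinv (by rintro m rfl; rfl) ?_
    exact (hinv nv.slot).enter (P := False) rfl hphase hview hvalid fun m => by
      simp [or_comm]
  | sendExec s x hx =>
    intro s'
    by_cases hs : s' = s
    · subst hs
      exact (hinv s').sendExec hx fun m => Iff.rfl
    · refine (hinv s').frame Set.subset_union_left ?_
      rintro m (hm | rfl) - hms
      · exact hm
      · exact absurd hms.symm hs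
  | learnExec s x M hnone hM hmatch =>
    refine SlotInv.setSlot (L := L) hinv (by simp) ?_
    rw [Set.union_empty]
    obtain ⟨m, hm, hj⟩ := hexec M hM fun m hm => (hmatch m hm).1
    obtain ⟨-, rfl, rfl⟩ := hmatch m hm
    exact (hinv m.slot).learnExec hj
  | executeNormal => simpa using hinv
  | executeUnblock => simpa using hinv

theorem Step.inv {conf : Request Client Op → Request Client Op → Prop} {k : ℕ}
    {faulty : Finset (Replica f)} (hfaulty : faulty.card ≤ f) {c c' : Config f Client Op}
    (h : Step conf k faulty c c') (hc : c.Inv faulty) : c'.Inv faulty := by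
  cases h with
  | idle => exact hc
  | issue => exact hc
  | byzantine m hm =>
    intro i hi s
    refine (hc i hi s).frame (Set.subset_insert _ _) ?_
    rintro m' (rfl | hm') hs -
    · exact absurd (hs ▸ hm) hi
    · exact hm'
  | correct i L' out hi hstep =>
    intro j hj s
    by_cases hij : j = i
    · subst hij
      simp only [Function.update_self]
      refine hstep.slotInv (hc j hj) (fun M hM hsent => ?_) s
      obtain ⟨m, hm, hmf⟩ := hM.exists_correct (faulty := faulty) (by omega)
      exact ⟨m, hm, (hc _ hmf m.slot).exec_sent m (hsent m hm) rfl rfl⟩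
    · simp only [Function.update_of_ne hij]
      refine (hc j hj s).frame Set.subset_union_left ?_
      rintro m (hm | hm) hs -
      · exact hm
      · exact absurd (hs.symm.trans (hstep.signer_eq m hm)) hij

theorem IsRun.inv {conf : Request Client Op → Request Client Op → Prop} {k : ℕ}
    {faulty : Finset (Replica f)} (hfaulty : faulty.card ≤ f) {σ : ℕ → Config f Client Op}
    (hσ : IsRun conf k faulty σ) (t : ℕ) : (σ t).Inv faulty := by
  induction t with
  | zero =>
    rw [hσ.1]
    exact fun i _ s => SlotInv.initial i s
  | succ t ih => exact (hσ.2 t).inv hfaulty ih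

/-! ## Agreement on the decision of a slot -/

section Agreement

theorem Verified.nonempty {sent : Set (Msg f Client Op)} {p : DepPropose f Client Op}
    {dv : Finset (DepVerify f Client Op)} (h : Verified sent p dv) (hf : f ≠ 0) : dv.Nonempty := by
  rw [← Finset.card_pos, h.1.1]
  omega

theorem Verified.prop_unique {sent : Set (Msg f Client Op)} {p p' : DepPropose f Client Op}
    {dv : Finset (DepVerify f Client Op)} (h : Verified sent p dv) (h' : Verified sent p' dv)
    (hf : f ≠ 0) : p = p' := by
  obtain ⟨m, hm⟩ := h.nonempty hf
  rw [← (h.2 m hm).2.1, ← (h'.2 m hm).2.1]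

/-- Prepares and Commits carry only a set of DepVerifys. Each DepVerify contains its proposal, so a
nonempty set determines the proposal, and the empty set means a no-op. This fails for f = 0, where a
quorum has no followers. -/
theorem ValidPair.prop_unique {sent : Set (Msg f Client Op)} {s : Slot f}
    {p p' : Option (DepPropose f Client Op)} {dv : Finset (DepVerify f Client Op)}
    (h : ValidPair sent s p dv) (h' : ValidPair sent s p' dv) (hf : f ≠ 0) : p = p' := by
  cases p with
  | none =>
    cases p' with
    | none => rfl
    | some q =>
      have := (h'.2 q rfl).2.2.2.nonempty hf
      simp [h.1 rfl] at this
  | some q =>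
    have hq := (h.2 q rfl).2.2.2
    cases p' with
    | none =>
      have := hq.nonempty hf
      simp [h'.1 rfl] at this
    | some q' => rw [hq.prop_unique (h'.2 q' rfl).2.2.2 hf]

open Classical in
/-- The coordinator and the followers whose dependency sets enter a decision. -/
def witnesses (p : DepPropose f Client Op) (dv : Finset (DepVerify f Client Op)) :
    Finset (Replica f) :=
  insert p.slot.coord (dv.image DepVerify.sender)

/-- The coordinator is not a member of its own quorum and adds one to the 2f followers, which makes
the reporters a quorum that can be intersected with others. -/
theorem Verified.card_witnesses {sent : Set (Msg f Client Op)} {p : DepPropose f Client Op}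
    {dv : Finset (DepVerify f Client Op)} (h : Verified sent p dv) (hq : ValidQuorum p) :
    (witnesses p dv).card = 2 * f + 1 := by
  classical
  unfold witnesses
  rw [Finset.card_insert_of_notMem, h.1.card_image]
  intro hmem
  obtain ⟨m, hm, hms⟩ := Finset.mem_image.1 hmem
  exact hq.2 (hms ▸ (h.2 m hm).2.2)

theorem Verified.exists_of_mem_quorum {sent : Set (Msg f Client Op)} {p : DepPropose f Client Op}
    {dv : Finset (DepVerify f Client Op)} (h : Verified sent p dv) (hq : ValidQuorum p)
    {i : Replica f} (hi : i ∈ p.quorum) : ∃ m ∈ dv, m.sender = i := by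
  classical
  have : dv.image DepVerify.sender = p.quorum := by
    refine Finset.eq_of_subset_of_card_le (fun j hj => ?_) (by rw [h.1.card_image, hq.1])
    obtain ⟨m, hm, rfl⟩ := Finset.mem_image.1 hj
    exact (h.2 m hm).2.2
  exact Finset.mem_image.1 (this ▸ hi)

/-- The selection rule prefers the reconciliation certificate of highest view, so the selected one
is at least as new as any reported one, and the Prepares inside it support `nv.dv` in an earlier
view. -/
theorem NewView.Valid.exists_hasPrepares {sent : Set (Msg f Client Op)} {nv : NewView f Client Op}
    (hv : nv.Valid sent) {m : ViewChange f Client Op} (hm : m ∈ nv.vcs) {w : ℤ}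
    (hc : m.cert.RpcFrom w) : ∃ w', w ≤ w' ∧ w' < nv.view ∧ HasPrepares sent nv.slot w' nv.dv := by
  obtain ⟨p, dv, preps, w₁, hc, hw⟩ := hc
  rcases hv.2.2 with ⟨m', hm', preps', w', hc', hmax⟩ | ⟨hno, -⟩ | ⟨hno, -⟩
  · have hval := (hv.2.1 m' hm').2.2.2
    rw [hc'] at hval
    obtain ⟨-, hlt, -, -, hd, hall⟩ := hval
    exact ⟨w', hw.trans (hmax m hm _ _ _ _ hc), hlt, preps', hd, hall⟩
  · exact absurd hc (hno m hm _ _ _ _)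
  · rw [hno m hm] at hc
    cases hc

variable {faulty : Finset (Replica f)} {c : Config f Client Op} (hfaulty : faulty.card ≤ f)
  (hc : c.Inv faulty)
include hfaulty hc

theorem HasPrepares.exists_correct {s : Slot f} {w : ℤ} {dv : Finset (DepVerify f Client Op)}
    (h : HasPrepares c.sent s w dv) :
    ∃ m : Prepare f Client Op, m.sender ∉ faulty ∧ Msg.prepare m ∈ c.sent ∧ m.slot = s ∧
      m.view = w ∧ m.dv = dv ∧ SlotInv c.sent m.sender s ((c.loc m.sender).slots s) := by
  obtain ⟨M, hM, hall⟩ := h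
  obtain ⟨m, hm, hmf⟩ := hM.exists_correct (faulty := faulty) (by omega)
  obtain ⟨h1, h2, h3, h4⟩ := hall m hm
  exact ⟨m, hmf, h1, h2, h3, h4, hc _ hmf s⟩

theorem HasPrepares.dv_unique {s : Slot f} {w : ℤ} {dv dv' : Finset (DepVerify f Client Op)}
    (h : HasPrepares c.sent s w dv) (h' : HasPrepares c.sent s w dv') : dv = dv' := by
  obtain ⟨M, hM, hall⟩ := h
  obtain ⟨M', hM', hall'⟩ := h'
  obtain ⟨m, hm, m', hm', hmf, hs⟩ := hM.exists_common hfaulty hM'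
  obtain ⟨h1, h2, h3, rfl⟩ := hall m hm
  obtain ⟨h1', h2', h3', rfl⟩ := hall' m' hm'
  exact (hc _ hmf s).prepare_unique m m' h1 rfl h2 h1' hs h2' (h3.trans h3'.symm)

theorem HasCommits.hasPrepares {s : Slot f} {w : ℤ} {dv : Finset (DepVerify f Client Op)}
    (h : HasCommits c.sent s w dv) : -1 ≤ w ∧ HasPrepares c.sent s w dv := by
  obtain ⟨M, hM, hall⟩ := h
  obtain ⟨m, hm, hmf⟩ := hM.exists_correct (faulty := faulty) (by omega)
  obtain ⟨h1, h2, rfl, rfl⟩ := hall m hm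
  exact (hc _ hmf s).commit_prepares m h1 rfl h2

/-- A commit quorum of the reconciliation path fixes what can be prepared in later views. -/
theorem HasCommits.lock {s : Slot f} {w : ℤ} {dv : Finset (DepVerify f Client Op)}
    (h : HasCommits c.sent s w dv) {v : ℤ} {dv' : Finset (DepVerify f Client Op)} (hwv : w ≤ v)
    (hv : HasPrepares c.sent s v dv') : dv' = dv := by
  obtain ⟨hw, hprep⟩ := h.hasPrepares hfaulty hc
  induction hn : (v - w).toNat using Nat.strong_induction_on generalizing v dv' with
  | _ n ih =>
    rcases hwv.eq_or_lt with rfl | hlt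
    · exact hv.dv_unique hfaulty hc hprep
    obtain ⟨m, hmf, h1, h2, rfl, rfl, hm⟩ := hv.exists_correct hfaulty hc
    -- From -1 ≤ w < v the view is nonnegative, so it was entered through a NewView.
    obtain ⟨nv, hnv, hnvs, hnvv, hnvd⟩ := hm.prepare_newView m h1 rfl h2 (by omega)
    obtain ⟨M, hM, hall⟩ := h
    obtain ⟨x, hx, y, hy, hxf, hyx⟩ := hM.exists_common hfaulty hnv.1
    obtain ⟨a1, a2, a3, -⟩ := hall x hx
    obtain ⟨b1, b2, b3, -⟩ := hnv.2.1 y hy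
    -- A correct replica both committed in view `w` and contributed to the NewView; it reported a
    -- reconciliation certificate of view at least `w`. The selected certificate lies in [w, v),
    -- where the induction hypothesis applies.
    have := (hc _ hxf s).commit_viewChange x y a1 rfl a2 b1 hyx (b2.trans hnvs) (by omega)
    obtain ⟨w', hw', hlt', hp'⟩ := hnv.exists_hasPrepares hy this
    rw [hnvs, hnvd] at hp'
    exact ih _ (by omega) (by omega) hp' rfl

open Classical in
/-- On the fast path, the union of the dependency sets does not depend on the faulty followers. -/
theorem FastOK.biUnion_subset {p : DepPropose f Client Op} {dv dv' : Finset (DepVerify f Client Op)}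
    (hq : ValidQuorum p) (hdv : Verified c.sent p dv) (hdv' : Verified c.sent p dv')
    (hfast : FastOK dv) : dv.biUnion DepVerify.deps ⊆ dv'.biUnion DepVerify.deps := by
  intro d hd
  obtain ⟨m, hm, hdm⟩ := Finset.mem_biUnion.1 hd
  have hcard := hfast m hm d hdm
  have hdist : FromDistinct _ DepVerify.sender (dv.filter (fun m' => d ∈ m'.deps)) :=
    ⟨rfl, fun x hx y hy h => hdv.1.2 x (Finset.mem_filter.1 hx).1 y (Finset.mem_filter.1 hy).1 h⟩
  -- One of the f+1 reporters of `d` is correct. It sent a single DepVerify for the slot, and `dv'`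
  -- contains one from every quorum member, so it is the same message.
  obtain ⟨x, hx, hxf⟩ := hdist.exists_correct (faulty := faulty) (by omega)
  obtain ⟨hx, hdx⟩ := Finset.mem_filter.1 hx
  obtain ⟨a1, a2, a3⟩ := hdv.2 x hx
  obtain ⟨y, hy, hyx⟩ := hdv'.exists_of_mem_quorum hq a3
  obtain ⟨b1, b2, b3⟩ := hdv'.2 y hy
  have := (hc _ hxf p.slot).depVerify_unique x y a1 rfl (by rw [a2]) b1 hyx (by rw [b2])
  exact Finset.mem_biUnion.2 ⟨y, hy, this ▸ hdx⟩

open Classical in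
/-- A quorum of `DepCommit`s fixes what can be prepared in a view. -/
theorem HasDepCommits.lock (hf : f ≠ 0) {s : Slot f} {p : DepPropose f Client Op}
    {dv : Finset (DepVerify f Client Op)} (h : HasDepCommits c.sent s dv) (hps : p.slot = s)
    (hp : Msg.depPropose p ∈ c.sent) (hq : ValidQuorum p) (hdv : Verified c.sent p dv)
    (hfast : FastOK dv) {v : ℤ} {dv' : Finset (DepVerify f Client Op)}
    (hv : HasPrepares c.sent s v dv') :
    Verified c.sent p dv' ∧ dv'.biUnion DepVerify.deps = dv.biUnion DepVerify.deps := by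
  obtain ⟨M, hM, hall⟩ := h
  -- No quorum can have prepared in view -1: it would share a correct replica with the DepCommit
  -- quorum, and this replica does not send both.
  have hpos : ∀ {v dv'}, HasPrepares c.sent s v dv' → 0 ≤ v := by
    rintro v dv' ⟨P, hP, hPall⟩
    obtain ⟨x, hx, y, hy, hxf, hyx⟩ := hM.exists_common hfaulty hP
    obtain ⟨a1, a2, -⟩ := hall x hx
    obtain ⟨b1, b2, rfl, -⟩ := hPall y hy
    exact (hc _ hxf s).depCommit_prepare x y a1 rfl a2 b1 hyx b2
  induction hn : v.toNat using Nat.strong_induction_on generalizing v dv' with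
  | _ n ih =>
    have hv0 := hpos hv
    obtain ⟨m, hmf, h1, h2, rfl, rfl, hm⟩ := hv.exists_correct hfaulty hc
    obtain ⟨nv, hnv, hnvs, hnvv, hnvd⟩ := hm.prepare_newView m h1 rfl h2 hv0
    -- With any reconciliation certificate present, the selected one comes from an earlier view and
    -- the induction applies. Otherwise the common correct replica reports a fast-path certificate,
    -- so a fast-path certificate is selected, possibly one of a faulty replica.
    by_cases hrpc : ∃ y ∈ nv.vcs, ∃ w, y.cert.RpcFrom w
    · obtain ⟨y, hy, w, hyw⟩ := hrpc
      obtain ⟨w', -, hlt, hp'⟩ := hnv.exists_hasPrepares hy hyw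
      rw [hnvs, hnvd] at hp'
      have := hpos hp'
      exact ih _ (by omega) hp' rfl
    · obtain ⟨x, hx, y, hy, hxf, hyx⟩ := hM.exists_common hfaulty hnv.1
      obtain ⟨a1, a2, a3⟩ := hall x hx
      obtain ⟨b1, b2, b3, -⟩ := hnv.2.1 y hy
      have hcert := (hc _ hxf s).depCommit_viewChange x y a1 rfl a2 b1 hyx (b2.trans hnvs)
      obtain ⟨p₁, hp₁⟩ := hcert.resolve_right fun h => hrpc ⟨y, hy, _, h⟩
      rcases hnv.2.2 with ⟨m', hm', preps', w', hc', -⟩ | ⟨-, z, hz, q, -, hzc⟩ | ⟨hno, -⟩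
      · exact absurd ⟨m', hm', w', _, _, _, _, hc', le_rfl⟩ hrpc
      · have hval := (hnv.2.1 z hz).2.2.2
        rw [hzc, hnvd, hnvs] at hval
        obtain ⟨c1, c2, c3, c4, c5⟩ := hval
        -- A correct replica sent a DepCommit and also supports `q`. As coordinator it proposed only
        -- once for the slot; as follower it verified `q`, so its DepCommit is for `q`, and the
        -- nonempty `dv` belongs to only one proposal.
        have hqp : q = p := by
          have hd : (M.image DepCommit.sender).card = 2 * f + 1 := hM.card_image
          obtain ⟨j, hjf, hj1, hj2⟩ :=
            exists_correct_of_quorums hfaulty (c4.card_witnesses c3) hd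
          obtain ⟨u, hu, rfl⟩ := Finset.mem_image.1 hj2
          obtain ⟨u1, u2, u3⟩ := hall u hu
          rcases Finset.mem_insert.1 hj1 with hco | hmem
          · exact (hc _ hjf s).depPropose_unique q p c2 c1 hp hps (by rw [← c1, hco])
          · obtain ⟨z', hz', hzs⟩ := Finset.mem_image.1 hmem
            obtain ⟨e1, e2, -⟩ := c4.2 z' hz'
            have := (hc _ hjf s).depCommit_depVerify u z' u1 rfl u2 e1 hzs (by rw [e2, c1])
            rw [e2, u3] at this
            exact this.prop_unique hdv hf
        subst hqp
        exact ⟨c4, (c5.biUnion_subset hfaulty hc c3 c4 hdv).antisymm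
          (hfast.biUnion_subset hfaulty hc c3 hdv c4)⟩
      · rw [hno y hy] at hp₁
        cases hp₁

/-- The mixed case of agreement. The two sets of DepVerifys may differ, but a decision depends only
on the proposal and the union of dependencies, and these are locked. -/
theorem HasDepCommits.decision_eq (hf : f ≠ 0) {s : Slot f} {S S' : SlotState f Client Op}
    (hS : ValidPair c.sent s S.prop S.dv) (hne : S.prop ≠ none) (hfast : FastOK S.dv)
    (h : HasDepCommits c.sent s S.dv) (hS' : ValidPair c.sent s S'.prop S'.dv) {w : ℤ}
    (h' : HasCommits c.sent s w S'.dv) : S.decision = S'.decision := by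
  classical
  obtain ⟨p, hp⟩ := Option.ne_none_iff_exists'.1 hne
  obtain ⟨a1, a2, a3, a4⟩ := hS.2 p hp
  obtain ⟨b1, b2⟩ := h.lock hfaulty hc hf a1 a2 a3 a4 hfast (h'.hasPrepares hfaulty hc).2
  have : S'.prop = some p := hS'.prop_unique
    ⟨by simp, fun q hq => by obtain rfl := Option.some.inj hq; exact ⟨a1, a2, a3, b1⟩⟩ hf
  unfold SlotState.decision
  rw [hp, this, b2]

theorem Justified.unique (hf : f ≠ 0) {s : Slot f} {x x' : Decision f Client Op}
    (h : Justified c.sent s x) (h' : Justified c.sent s x') : x = x' := by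
  obtain ⟨S, rfl, hS, hj⟩ := h
  obtain ⟨S', rfl, hS', hj'⟩ := h'
  have hdec : S.dv = S'.dv → S.decision = S'.decision := fun hd => by
    have : S.prop = S'.prop := hS.prop_unique (hd ▸ hS') hf
    unfold SlotState.decision
    rw [this, hd]
  rcases hj with ⟨h1, h2, h3⟩ | ⟨w, h1⟩ <;> rcases hj' with ⟨h1', h2', h3'⟩ | ⟨w', h1'⟩
  · obtain ⟨M, hM, hall⟩ := h3
    obtain ⟨M', hM', hall'⟩ := h3'
    obtain ⟨x, hx, y, hy, hxf, hyx⟩ := hM.exists_common hfaulty hM'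
    obtain ⟨a1, a2, a3⟩ := hall x hx
    obtain ⟨b1, b2, b3⟩ := hall' y hy
    refine hdec ?_
    rw [← a3, ← b3]
    exact (hc _ hxf s).depCommit_unique x y a1 rfl a2 b1 hyx b2
  · exact HasDepCommits.decision_eq hfaulty hc hf hS h1 h2 h3 hS' h1'
  · exact (HasDepCommits.decision_eq hfaulty hc hf hS' h1' h2' h3' hS h1).symm
  · refine hdec ?_
    rcases le_total w w' with hw | hw
    · exact (h1.lock hfaulty hc hw (h1'.hasPrepares hfaulty hc).2).symm
    · exact h1'.lock hfaulty hc hw (h1.hasPrepares hfaulty hc).2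

end Agreement

/-! ## Dependencies of conflicting requests -/

/-- The compact dependency set `D` contains `v`, or a later slot of the same coordinator. -/
def Covers (D : Finset (Slot f)) (v : Slot f) : Prop :=
  ∃ d ∈ D, v.coord = d.coord ∧ v.seq ≤ d.seq

theorem Covers.mono {D D' : Finset (Slot f)} {v : Slot f} (h : Covers D v) (hD : D ⊆ D') :
    Covers D' v :=
  let ⟨d, hd, hv⟩ := h
  ⟨d, hD hd, hv⟩

/-- The compact set keeps only the latest conflicting slot of each coordinator; that slot covers `s`
because it is maximal. -/
theorem Local.covers_conflicts {conf : Request Client Op → Request Client Op → Prop}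
    {L : Local f Client Op} {s : Slot f} {a b : Request Client Op} (h : (s, a) ∈ L.known)
    (hab : conf a b) : Covers (L.conflicts conf b) s := by
  classical
  set C := (L.known.filter (fun x => conf x.2 b)).image Prod.fst with hC
  have hs : s ∈ C.filter (fun d => d.coord = s.coord) := by
    refine Finset.mem_filter.2 ⟨Finset.mem_image.2 ⟨(s, a), ?_, rfl⟩, rfl⟩
    exact Finset.mem_filter.2 ⟨h, hab⟩
  obtain ⟨d, hd, hmax⟩ := Finset.exists_max_image _ Slot.seq ⟨s, hs⟩
  obtain ⟨hd, hds⟩ := Finset.mem_filter.1 hd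
  refine ⟨d, ?_, hds.symm, hmax s hs⟩
  unfold Local.conflicts
  refine Finset.mem_filter.2 ⟨?_, fun d' hd' hc => hmax d' (Finset.mem_filter.2 ⟨?_, hc.trans hds⟩)⟩
  · convert hd
  · convert hd'

/-- Replica `i` has reported the dependency set `D` for request `b` in slot `s`. -/
def Witness (sent : Set (Msg f Client Op)) (i : Replica f) (s : Slot f) (b : Request Client Op)
    (D : Finset (Slot f)) : Prop :=
  (s.coord = i ∧ ∃ p, Msg.depPropose p ∈ sent ∧ p.slot = s ∧ p.req = b ∧ p.deps = D) ∨
    ∃ m : DepVerify f Client Op, Msg.depVerify m ∈ sent ∧ m.sender = i ∧ m.prop.slot = s ∧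
      m.prop.req = b ∧ m.deps = D

/-- Turns a decision into a quorum of reporters whose individual sets are all contained in the
committed dependency set. A single correct member then suffices to place a slot in it. -/
theorem Justified.exists_witnesses {sent : Set (Msg f Client Op)} {s : Slot f}
    {b : Request Client Op} {D : Finset (Slot f)} (h : Justified sent s (some b, D)) :
    (∃ p, Msg.depPropose p ∈ sent ∧ p.req = b) ∧
    ∃ A : Finset (Replica f), A.card = 2 * f + 1 ∧ ∀ i ∈ A, ∃ D' ⊆ D, Witness sent i s b D' := by
  classical
  obtain ⟨S, hx, hS, -⟩ := h
  obtain ⟨hb, hD⟩ := Prod.mk.inj hx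
  cases hp : S.prop with
  | none => simp [hp] at hb
  | some p =>
    obtain ⟨h1, h2, h3, h4⟩ := hS.2 p hp
    simp only [hp, Option.map_some, Option.some.injEq] at hb
    simp only [hp, Option.elim_some] at hD
    refine ⟨⟨p, h2, hb.symm⟩, _, h4.card_witnesses h3, fun i hi => ?_⟩
    rcases Finset.mem_insert.1 hi with rfl | hi
    · refine ⟨p.deps, ?_, Or.inl ⟨by rw [h1], p, h2, h1, hb.symm, rfl⟩⟩
      rw [hD]
      exact Finset.subset_union_left
    · obtain ⟨m, hm, rfl⟩ := Finset.mem_image.1 hi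
      obtain ⟨a1, a2, -⟩ := h4.2 m hm
      refine ⟨m.deps, ?_, Or.inr ⟨m, a1, rfl, by rw [a2, h1], by rw [a2, hb], rfl⟩⟩
      rw [hD]
      exact (Finset.subset_biUnion_of_mem DepVerify.deps hm).trans Finset.subset_union_right

/-! ### Effect of one step on known requests and reported dependencies -/

section Step

variable {conf : Request Client Op → Request Client Op → Prop} {k : ℕ}

theorem Local.enter_known (L : Local f Client Op) (nv : NewView f Client Op) :
    L.known ⊆ (L.enter nv).known := by
  classical
  unfold Local.enter
  split
  · exact Finset.subset_insert _ _
  · exact Finset.Subset.refl _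

theorem LocalStep.known_mono {issued : Set (Request Client Op)} {sent out : Set (Msg f Client Op)}
    {i : Replica f} {L L' : Local f Client Op} (h : LocalStep conf k issued sent i L L' out) :
    L.known ⊆ L'.known := by
  classical
  cases h with
  | propose p => exact Finset.subset_insert (p.slot, p.req) L.known
  | accept p => exact Finset.subset_insert (p.slot, p.req) L.known
  | sendNewView nv => exact L.enter_known nv
  | acceptNewView nv => exact L.enter_known nv
  | _ => exact Finset.Subset.refl _

theorem LocalStep.depPropose_out {issued : Set (Request Client Op)}
    {sent out : Set (Msg f Client Op)} {i : Replica f} {L L' : Local f Client Op}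
    (h : LocalStep conf k issued sent i L L' out) {p : DepPropose f Client Op}
    (hp : Msg.depPropose p ∈ out) :
    p.deps = L.conflicts conf p.req ∧ (p.slot, p.req) ∈ L'.known ∧
      ∀ m ∈ out, m.slot = p.slot := by
  classical
  cases h with
  | propose q _ _ _ hdeps =>
    obtain rfl : p = q := by simpa using hp
    exact ⟨hdeps, Finset.mem_insert_self _ _, by rintro m rfl; rfl⟩
  | _ => simp at hp

theorem LocalStep.depVerify_out {issued : Set (Request Client Op)}
    {sent out : Set (Msg f Client Op)} {i : Replica f} {L L' : Local f Client Op}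
    (h : LocalStep conf k issued sent i L L' out) {m : DepVerify f Client Op}
    (hm : Msg.depVerify m ∈ out) :
    m.deps = L.conflicts conf m.prop.req ∧ (m.prop.slot, m.prop.req) ∈ L'.known ∧
      ∀ m' ∈ out, m'.slot = m.prop.slot := by
  classical
  cases h with
  | accept q =>
    obtain rfl := Msg.depVerify.inj hm.2
    exact ⟨rfl, Finset.mem_insert_self _ _, by rintro m ⟨-, rfl⟩; rfl⟩
  | _ => simp at hm

variable {faulty : Finset (Replica f)} {c c' : Config f Client Op}

theorem Step.sent_mono (h : Step conf k faulty c c') : c.sent ⊆ c'.sent := by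
  cases h with
  | byzantine => exact Set.subset_insert _ _
  | correct => exact Set.subset_union_left
  | _ => exact Set.Subset.refl _

theorem Step.loc_known_mono (h : Step conf k faulty c c') (i : Replica f) :
    (c.loc i).known ⊆ (c'.loc i).known := by
  cases h with
  | correct j L' out hj hstep =>
    by_cases hij : i = j
    · subst hij
      simpa using hstep.known_mono
    · simp [Function.update_of_ne hij]
  | _ => exact Finset.Subset.refl _

/-- When a correct replica reports dependencies, they are computed from the requests that it has
learned before, and it learns the request. -/
theorem Step.witness (h : Step conf k faulty c c') {i : Replica f} (hi : i ∉ faulty) {s : Slot f}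
    {b : Request Client Op} {D : Finset (Slot f)} (hw : Witness c'.sent i s b D) :
    Witness c.sent i s b D ∨ (D = (c.loc i).conflicts conf b ∧ (s, b) ∈ (c'.loc i).known ∧
      ∀ s' b' D', Witness c'.sent i s' b' D' → s' = s ∨ Witness c.sent i s' b' D') := by
  cases h with
  | idle => exact Or.inl hw
  | issue => exact Or.inl hw
  | byzantine m hm =>
    left
    rcases hw with ⟨h1, p, hp, h2⟩ | ⟨m', hm', h2⟩
    · rcases hp with rfl | hp
      · refine absurd ?_ hi
        rw [← h1, ← h2.1]
        exact hm
      · exact Or.inl ⟨h1, p, hp, h2⟩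
    · rcases hm' with rfl | hm'
      · exact absurd (h2.1 ▸ hm) hi
      · exact Or.inr ⟨m', hm', h2⟩
  | correct j L' out hj hstep =>
    have hother : ∀ s' b' D', Witness (c.sent ∪ out) i s' b' D' →
        Witness c.sent i s' b' D' ∨ i = j ∧ ∃ m ∈ out, m.slot = s' := by
      rintro s' b' D' (⟨h1, p, hp | hp, h2⟩ | ⟨m, hm | hm, h2⟩)
      · exact Or.inl (Or.inl ⟨h1, p, hp, h2⟩)
      · have := hstep.signer_eq _ hp
        exact Or.inr ⟨by rw [← this, ← h1, ← h2.1]; rfl, _, hp, h2.1⟩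
      · exact Or.inl (Or.inr ⟨m, hm, h2⟩)
      · have := hstep.signer_eq _ hm
        exact Or.inr ⟨by rw [← this, ← h2.1]; rfl, _, hm, h2.2.1⟩
    rcases hother s b D hw with hold | ⟨rfl, -⟩
    · exact Or.inl hold
    simp only [Function.update_self]
    rcases hw with ⟨h1, p, hp | hp, rfl, rfl, rfl⟩ | ⟨m, hm | hm, h1, rfl, rfl, rfl⟩
    · exact Or.inl (Or.inl ⟨h1, p, hp, rfl, rfl, rfl⟩)
    · obtain ⟨e1, e2, e3⟩ := hstep.depPropose_out hp
      refine Or.inr ⟨e1, e2, fun s' b' D' hw' => ?_⟩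
      rcases hother _ _ _ hw' with h | ⟨-, m, hm, rfl⟩
      · exact Or.inr h
      · exact Or.inl (e3 m hm)
    · exact Or.inl (Or.inr ⟨m, hm, h1, rfl, rfl, rfl⟩)
    · obtain ⟨e1, e2, e3⟩ := hstep.depVerify_out hm
      refine Or.inr ⟨e1, e2, fun s' b' D' hw' => ?_⟩
      rcases hother _ _ _ hw' with h | ⟨-, m, hm, rfl⟩
      · exact Or.inr h
      · exact Or.inl (e3 m hm)

end Step

/-! ### Dependencies between committed slots along a run -/

section Run

variable {conf : Request Client Op → Request Client Op → Prop} {k : ℕ}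
  {faulty : Finset (Replica f)} {σ : ℕ → Config f Client Op} (hσ : IsRun conf k faulty σ)
include hσ

theorem IsRun.sent_mono : Monotone fun t => (σ t).sent :=
  monotone_nat_of_le_succ fun t => (hσ.2 t).sent_mono

theorem IsRun.known_mono (i : Replica f) : Monotone fun t => ((σ t).loc i).known :=
  monotone_nat_of_le_succ fun t => (hσ.2 t).loc_known_mono i

theorem IsRun.not_witness_zero {i : Replica f} {s : Slot f} {b : Request Client Op}
    {D : Finset (Slot f)} : ¬ Witness (σ 0).sent i s b D := by
  rw [hσ.1]
  simp [Witness, Config.initial]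

theorem IsRun.known_of_witness {i : Replica f} (hi : i ∉ faulty) {t : ℕ} {s : Slot f}
    {b : Request Client Op} {D : Finset (Slot f)} (h : Witness (σ t).sent i s b D) :
    (s, b) ∈ ((σ t).loc i).known := by
  induction t with
  | zero => exact absurd h hσ.not_witness_zero
  | succ t ih =>
    rcases (hσ.2 t).witness hi h with h | h
    · exact hσ.known_mono i t.le_succ (ih h)
    · exact h.2.1

/-- The report on `b` is made in some step after `t`. Known requests are never forgotten, so `a`
enters its computation. -/
theorem IsRun.covers_of_known {i : Replica f} (hi : i ∉ faulty) {t t' : ℕ} (htt : t ≤ t')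
    {s s' : Slot f} {a b : Request Client Op} {D : Finset (Slot f)} (hab : conf a b)
    (ha : (s, a) ∈ ((σ t).loc i).known) (hb : ¬ Witness (σ t).sent i s' b D)
    (hb' : Witness (σ t').sent i s' b D) : Covers D s := by
  induction t', htt using Nat.le_induction with
  | base => exact absurd hb' hb
  | succ t' htt ih =>
    rcases (hσ.2 t').witness hi hb' with h | h
    · exact ih h
    · rw [h.1]
      exact Local.covers_conflicts (hσ.known_mono i htt ha) hab

/-- Of two conflicting requests, the one reported later depends on the other one. -/
theorem IsRun.covers_or_covers (hsymm : ∀ a b, conf a b → conf b a) {i : Replica f}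
    (hi : i ∉ faulty) {t : ℕ} {s s' : Slot f} (hs : s ≠ s') {a b : Request Client Op}
    (hab : conf a b) {D D' : Finset (Slot f)} (ha : Witness (σ t).sent i s a D)
    (hb : Witness (σ t).sent i s' b D') : Covers D' s ∨ Covers D s' := by
  induction t with
  | zero => exact absurd ha hσ.not_witness_zero
  | succ t ih =>
    rcases (hσ.2 t).witness hi ha with h | ⟨h1, -, h2⟩
    · rcases (hσ.2 t).witness hi hb with h' | ⟨h1', -⟩
      · exact ih h h'
      · left
        rw [h1']
        exact Local.covers_conflicts (hσ.known_of_witness hi h) hab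
    · right
      rw [h1]
      -- A step reports on one slot only, so the report on `s'` is older than the one on `s`.
      have := (h2 _ _ _ hb).resolve_left (Ne.symm hs)
      exact Local.covers_conflicts (hσ.known_of_witness hi this) (hsymm _ _ hab)

theorem IsRun.exec_justified (hfaulty : faulty.card ≤ f) {r : Replica f} (hr : r ∉ faulty) {t : ℕ}
    {s : Slot f} {x : Decision f Client Op} (h : (((σ t).loc r).slots s).exec = some x) :
    Justified (σ t).sent s x :=
  (hσ.inv hfaulty t r hr s).exec_state x h

/-- Two slots that are committed with conflicting requests depend on each other. -/
theorem IsRun.covers_of_conflict (hfaulty : faulty.card ≤ f) (hsymm : ∀ a b, conf a b → conf b a)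
    {r r' : Replica f} (hr : r ∉ faulty) (hr' : r' ∉ faulty) {t t' : ℕ} {s s' : Slot f}
    {a b : Request Client Op} {D D' : Finset (Slot f)} (hs : s ≠ s') (hab : conf a b)
    (ha : (((σ t).loc r).slots s).exec = some (some a, D))
    (hb : (((σ t').loc r').slots s').exec = some (some b, D')) : Covers D' s ∨ Covers D s' := by
  obtain ⟨-, A, hA, hAw⟩ := ((hσ.exec_justified hfaulty hr ha).mono
    (hσ.sent_mono (le_max_left t t'))).exists_witnesses
  obtain ⟨-, B, hB, hBw⟩ := ((hσ.exec_justified hfaulty hr' hb).mono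
    (hσ.sent_mono (le_max_right t t'))).exists_witnesses
  obtain ⟨i, hi, hiA, hiB⟩ := exists_correct_of_quorums hfaulty hA hB
  obtain ⟨E, hE, hw⟩ := hAw i hiA
  obtain ⟨E', hE', hw'⟩ := hBw i hiB
  exact (hσ.covers_or_covers hsymm hi hs hab hw hw').imp (·.mono hE') (·.mono hE)

/-- A slot whose request has not been proposed before another slot is committed with a
conflicting request depends on that slot. -/
theorem IsRun.covers_of_not_proposed (hfaulty : faulty.card ≤ f) {r r' : Replica f}
    (hr : r ∉ faulty) (hr' : r' ∉ faulty) {t t' : ℕ} {s s' : Slot f}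
    {a b : Request Client Op} {D D' : Finset (Slot f)} (hab : conf a b)
    (ha : (((σ t).loc r).slots s).exec = some (some a, D)) (hnb : ¬ (σ t).Proposed b)
    (hb : (((σ t').loc r').slots s').exec = some (some b, D')) : Covers D' s := by
  obtain ⟨-, A, hA, hAw⟩ := (hσ.exec_justified hfaulty hr ha).exists_witnesses
  obtain ⟨⟨p, hp, hpb⟩, B, hB, hBw⟩ := (hσ.exec_justified hfaulty hr' hb).exists_witnesses
  obtain ⟨i, hi, hiA, hiB⟩ := exists_correct_of_quorums hfaulty hA hB
  obtain ⟨E, hE, hw⟩ := hAw i hiA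
  obtain ⟨E', hE', hw'⟩ := hBw i hiB
  rcases le_total t t' with htt | htt
  · refine (hσ.covers_of_known hi htt hab (hσ.known_of_witness hi hw) ?_ hw').mono hE'
    rintro (⟨-, q, hq, -, hqb, -⟩ | ⟨m, hm, hmi, -, hmb, -⟩)
    · exact hnb ⟨q, hq, hqb⟩
    -- A correct follower verifies only a DepPropose that has been sent, so an earlier report on `b`
    -- would mean that `b` was proposed.
    · exact hnb ⟨m.prop, ((hσ.inv hfaulty t i hi _).depVerify_state m hm hmi rfl).2.1, hmb⟩
  · exact absurd ⟨p, hσ.sent_mono htt hp, hpb⟩ hnb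

end Run

/-! ## Execution sequences -/

/-- The slots outside `E` that are inside the execution window when `E` has been executed. -/
def openWindow (k : ℕ) (E : Set (Slot f)) : Set (Slot f) :=
  {v | v ∉ E ∧ v.seq < sInf {n | (⟨v.coord, n⟩ : Slot f) ∉ E} + k}

/-- When `E` has been executed, `l` is a strongly connected component of the dependency graph `G`
on the window that may be executed next. -/
structure Enabled (G : Slot f → Slot f → Prop) (k : ℕ) (E : Set (Slot f)) (l : List (Slot f)) :
    Prop where
  ne_nil : l ≠ []
  sorted : l.Pairwise SlotBefore
  subset : ∀ x ∈ l, x ∈ openWindow k E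
  connected : ∀ x ∈ l, ∀ y ∈ l, Relation.ReflTransGen (fun x y => G x y ∧ y ∈ l) x y
  closed : ∀ x ∈ l, ∀ y ∈ openWindow k E, G x y → y ∈ l

/-- Starting from `E`, the components in the list may be executed one after the other. -/
inductive ExecSeq (G : Slot f → Slot f → Prop) (k : ℕ) : Set (Slot f) → List (List (Slot f)) → Prop
  | nil (E : Set (Slot f)) : ExecSeq G k E []
  | cons {E : Set (Slot f)} {l : List (Slot f)} {ls : List (List (Slot f))}
      (hl : Enabled G k E l) (hls : ExecSeq G k (E ∪ {x | x ∈ l}) ls) : ExecSeq G k E (l :: ls)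

theorem SlotBefore.asymm {u v : Slot f} (h : SlotBefore u v) : ¬ SlotBefore v u := by
  rintro (h' | ⟨h1', h2'⟩) <;> rcases h with h | ⟨h1, h2⟩
  · omega
  · omega
  · omega
  · exact absurd h2 h2'.asymm

theorem pairwise_slotBefore_nodup {l : List (Slot f)} (h : l.Pairwise SlotBefore) : l.Nodup :=
  h.imp fun {a b} hab hne => by subst hne; exact hab.asymm hab

theorem pair_sublist_append {α : Type*} {u v : α} {A B : List α} :
    [u, v].Sublist (A ++ B) ↔ [u, v].Sublist A ∨ (u ∈ A ∧ v ∈ B) ∨ [u, v].Sublist B := by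
  constructor
  · intro h
    obtain ⟨l₁, l₂, h, h1, h2⟩ := List.sublist_append_iff.1 h
    rcases l₁ with _ | ⟨a, _ | ⟨b, _ | ⟨c, l⟩⟩⟩
    · exact Or.inr (Or.inr (by simpa [h] using h2))
    · simp only [List.cons_append, List.nil_append, List.cons.injEq] at h
      obtain ⟨rfl, rfl⟩ := h
      exact Or.inr (Or.inl ⟨by simpa using h1, by simpa using h2⟩)
    · simp only [List.cons_append, List.nil_append, List.cons.injEq] at h
      obtain ⟨rfl, rfl, rfl⟩ := h
      exact Or.inl h1
    · simp at h
  · rintro (h | ⟨h1, h2⟩ | h)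
    · exact h.trans (List.sublist_append_left _ _)
    · exact (List.singleton_sublist.2 h1).append (List.singleton_sublist.2 h2)
    · exact h.trans (List.sublist_append_right _ _)

variable {G : Slot f → Slot f → Prop} {k : ℕ} {E : Set (Slot f)}

/-- A path inside `l` starting at a common slot cannot leave `l'`: its slots lie in the window,
where `l'` is closed. -/
theorem Enabled.mem_of_mem {l l' : List (Slot f)} (h : Enabled G k E l) (h' : Enabled G k E l')
    {x : Slot f} (hx : x ∈ l) (hx' : x ∈ l') {y : Slot f} (hy : y ∈ l) : y ∈ l' := by
  induction h.connected x hx y hy with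
  | refl => exact hx'
  | tail _ hstep ih =>
    rename_i b c hab
    by_cases hb : b ∈ l
    · exact h'.closed _ (ih hb) _ (h.subset _ hstep.2) hstep.1
    · rcases hab.cases_tail with rfl | ⟨d, -, hd⟩
      · exact absurd hx hb
      · exact absurd hd.2 hb

/-- Overlapping components have the same members, and the asymmetric order `SlotBefore` admits only
one sorted arrangement. -/
theorem Enabled.eq_of_mem {l l' : List (Slot f)} (h : Enabled G k E l) (h' : Enabled G k E l')
    {x : Slot f} (hx : x ∈ l) (hx' : x ∈ l') : l = l' := by
  have hp : l.Perm l' := (List.perm_ext_iff_of_nodup (pairwise_slotBefore_nodup h.sorted)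
    (pairwise_slotBefore_nodup h'.sorted)).2
      fun y => ⟨h.mem_of_mem h' hx hx', h'.mem_of_mem h hx' hx⟩
  exact hp.eq_of_pairwise (fun a b _ _ hab hba => absurd hba hab.asymm) h.sorted h'.sorted

/-- An edge would put a slot of `l'` into `l` by closedness, and overlapping components coincide. -/
theorem Enabled.not_dep {l l' : List (Slot f)} (h : Enabled G k E l) (h' : Enabled G k E l')
    (hne : l ≠ l') {x y : Slot f} (hx : x ∈ l) (hy : y ∈ l') : ¬ G x y := fun hxy =>
  hne (h.eq_of_mem h' (h.closed x hx y (h'.subset y hy) hxy) hy)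

/-- Executing a component does not affect the other components that may be executed. -/
theorem Enabled.after (hG : ∀ u v w, G u v → w.coord = v.coord → w.seq ≤ v.seq → G u w)
    {l l' : List (Slot f)} (h : Enabled G k E l) (h' : Enabled G k E l') (hne : l ≠ l') :
    Enabled G k (E ∪ {x | x ∈ l'}) l where
  ne_nil := h.ne_nil
  sorted := h.sorted
  connected := h.connected
  subset := by
    intro x hx
    obtain ⟨h1, h2⟩ := h.subset x hx
    have hx' : x ∉ E ∪ {x | x ∈ l'} := by
      rintro (hxE | hxl)
      · exact h1 hxE
      · exact hne (h.eq_of_mem h' hx hxl)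
    refine ⟨hx', lt_of_lt_of_le h2 (Nat.add_le_add_right ?_ k)⟩
    -- Executing more slots can only raise the oldest unexecuted counter, so the window never
    -- shrinks around an unexecuted slot.
    refine csInf_le_csInf (OrderBot.bddBelow _) ⟨x.seq, hx'⟩ fun n hn hnE => hn (Or.inl hnE)
  closed := by
    rintro x hx y ⟨hy1, hy2⟩ hxy
    have hyE : y ∉ E := fun hyE => hy1 (Or.inl hyE)
    by_contra hyl
    -- If `y` was in the old window, `l` was closed towards it. The remaining danger is that `y`
    -- entered the window because `l'` advanced it.
    have hyw : sInf {n | (⟨y.coord, n⟩ : Slot f) ∉ E} + k ≤ y.seq := by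
      by_contra hlt
      exact hyl (h.closed x hx y ⟨hyE, not_le.1 hlt⟩ hxy)
    have hroot : (⟨y.coord, sInf {n | (⟨y.coord, n⟩ : Slot f) ∉ E}⟩ : Slot f) ∉ E :=
      Nat.sInf_mem (s := {n | (⟨y.coord, n⟩ : Slot f) ∉ E}) ⟨y.seq, hyE⟩
    have hk : 0 < k := by
      obtain ⟨h1, h2⟩ := h.subset x hx
      have : sInf {n | (⟨x.coord, n⟩ : Slot f) ∉ E} ≤ x.seq := Nat.sInf_le h1
      omega
    -- A dependency on `y` includes all earlier slots of its coordinator, in particular the oldest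
    -- unexecuted one. This lies in the window since 0 < k, so it belongs to `l` and not to `l'`.
    -- Hence `l'` did not advance this window after all.
    have hmem := h.closed x hx ⟨y.coord, sInf {n | (⟨y.coord, n⟩ : Slot f) ∉ E}⟩
      ⟨hroot, Nat.lt_add_of_pos_right hk⟩ (hG _ _ _ hxy rfl (by dsimp only; omega))
    have hle : sInf {n | (⟨y.coord, n⟩ : Slot f) ∉ E ∪ {x | x ∈ l'}} ≤
        sInf {n | (⟨y.coord, n⟩ : Slot f) ∉ E} := by
      refine Nat.sInf_le ?_
      rintro (hin | hin)
      · exact hroot hin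
      · exact hne (h.eq_of_mem h' hmem hin)
    omega

theorem ExecSeq.notMem {ls : List (List (Slot f))} (h : ExecSeq G k E ls) {x : Slot f}
    (hx : x ∈ ls.flatten) : x ∉ E := by
  induction h with
  | nil => simp at hx
  | cons hl _ ih =>
    rw [List.flatten_cons, List.mem_append] at hx
    rcases hx with hx | hx
    · exact (hl.subset x hx).1
    · exact fun hE => ih hx (Or.inl hE)

theorem ExecSeq.nodup {ls : List (List (Slot f))} (h : ExecSeq G k E ls) : ls.flatten.Nodup := by
  induction h with
  | nil => simp
  | cons hl hls ih =>
    rw [List.flatten_cons, List.nodup_append]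
    exact ⟨pairwise_slotBefore_nodup hl.sorted, ih,
      fun a ha b hb hab => hls.notMem hb (Or.inr (hab ▸ ha))⟩

theorem ExecSeq.concat {ls : List (List (Slot f))} (h : ExecSeq G k E ls) {l : List (Slot f)}
    (hl : Enabled G k (E ∪ {x | x ∈ ls.flatten}) l) : ExecSeq G k E (ls ++ [l]) := by
  induction h with
  | nil => exact .cons (by simpa using hl) (.nil _)
  | cons hl' _ ih =>
    refine .cons hl' (ih ?_)
    convert hl using 1
    ext x
    simp [or_assoc]

/-- A component that may be executed first is executed in the sequence, without interaction with
the components before it, or may still be executed after the sequence. -/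
theorem ExecSeq.residual (hG : ∀ u v w, G u v → w.coord = v.coord → w.seq ≤ v.seq → G u w)
    {ls : List (List (Slot f))} (h : ExecSeq G k E ls) {l : List (Slot f)}
    (hl : Enabled G k E l) :
    (∃ A B, ls = A ++ l :: B ∧ ExecSeq G k (E ∪ {x | x ∈ l}) (A ++ B) ∧
      ∀ x ∈ A.flatten, ∀ y ∈ l, ¬ (G x y ∨ G y x)) ∨
    (ExecSeq G k (E ∪ {x | x ∈ l}) ls ∧ ∀ x ∈ ls.flatten, ∀ y ∈ l, ¬ (G x y ∨ G y x)) := by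
  induction h with
  | nil => exact Or.inr ⟨.nil _, by simp⟩
  | @cons E l₀ ls hl₀ hls ih =>
    by_cases hne : l = l₀
    · subst hne
      exact Or.inl ⟨[], ls, rfl, hls, by simp⟩
    -- The diamond step: distinct enabled components are independent, and by `Enabled.after` each
    -- stays enabled after the other.
    have hdep : ∀ x ∈ l₀, ∀ y ∈ l, ¬ (G x y ∨ G y x) := fun x hx y hy hxy =>
      hxy.elim (hl₀.not_dep hl (Ne.symm hne) hx hy) (hl.not_dep hl₀ hne hy hx)
    have hl₀' := hl₀.after hG hl (Ne.symm hne)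
    rcases ih (hl.after hG hl₀ hne) with ⟨A, B, rfl, h1, h2⟩ | ⟨h1, h2⟩
    · refine Or.inl ⟨l₀ :: A, B, rfl, .cons hl₀' (Set.union_right_comm _ _ _ ▸ h1), ?_⟩
      intro x hx
      rw [List.flatten_cons, List.mem_append] at hx
      exact hx.elim (hdep x) (h2 x)
    · refine Or.inr ⟨.cons hl₀' (Set.union_right_comm _ _ _ ▸ h1), ?_⟩
      intro x hx
      rw [List.flatten_cons, List.mem_append] at hx
      exact hx.elim (hdep x) (h2 x)

/-- Any two execution sequences execute dependent slots in the same order. -/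
theorem ExecSeq.order (hG : ∀ u v w, G u v → w.coord = v.coord → w.seq ≤ v.seq → G u w)
    {ls ls' : List (List (Slot f))} (h : ExecSeq G k E ls) (h' : ExecSeq G k E ls') {u v : Slot f}
    (huv : G u v ∨ G v u) (hbefore : [u, v].Sublist ls.flatten) (hv : v ∈ ls'.flatten) :
    [u, v].Sublist ls'.flatten := by
  induction h' generalizing ls with
  | nil => simp at hv
  | @cons E l ls' hl hls' ih =>
    rw [List.flatten_cons, List.mem_append] at hv
    rw [List.flatten_cons, pair_sublist_append]
    -- The first component `l` of the second sequence is moved to the front of the first one and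
    -- removed. Only components independent of `l` are passed, so the order of the dependent pair is
    -- unaffected and induction handles the remainder.
    rcases h.residual hG hl with ⟨A, B, rfl, h1, h2⟩ | ⟨h1, h2⟩
    · have hdis : ∀ x ∈ l, x ∉ A.flatten ∧ x ∉ B.flatten := fun x hx =>
        ⟨fun hA => h1.notMem (by simp_all) (Or.inr hx),
          fun hB => h1.notMem (by simp_all) (Or.inr hx)⟩
      have hmem : ∀ {x y}, [x, y].Sublist A.flatten → x ∈ A.flatten ∧ y ∈ A.flatten :=
        fun h => ⟨h.subset (by simp), h.subset (by simp)⟩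
      have hmem' : ∀ {x y}, [x, y].Sublist B.flatten → x ∈ B.flatten ∧ y ∈ B.flatten :=
        fun h => ⟨h.subset (by simp), h.subset (by simp)⟩
      have hmem'' : ∀ {x y}, [x, y].Sublist l → x ∈ l ∧ y ∈ l :=
        fun h => ⟨h.subset (by simp), h.subset (by simp)⟩
      rw [List.flatten_append, List.flatten_cons, pair_sublist_append, pair_sublist_append,
        List.mem_append] at hbefore
      have ih' : [u, v].Sublist (A ++ B).flatten → v ∈ ls'.flatten → [u, v].Sublist ls'.flatten :=
        fun ha hb => ih h1 ha hb
      rw [List.flatten_append, pair_sublist_append] at ih'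
      by_cases hvl : v ∈ l
      · rcases hbefore with hb | ⟨hb, -⟩ | hb | ⟨-, hb⟩ | hb
        · exact absurd (hmem hb).2 (hdis v hvl).1
        · exact absurd huv (h2 u hb v hvl)
        · exact Or.inl hb
        · exact absurd hb (hdis v hvl).2
        · exact absurd (hmem' hb).2 (hdis v hvl).2
      · have hv' := hv.resolve_left hvl
        rcases hbefore with hb | ⟨hb, hb'⟩ | hb | ⟨hb, -⟩ | hb
        · exact Or.inr (Or.inr (ih' (Or.inl hb) hv'))
        · exact Or.inr (Or.inr (ih' (Or.inr (Or.inl ⟨hb, hb'.resolve_left hvl⟩)) hv'))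
        · exact absurd (hmem'' hb).2 hvl
        · exact Or.inr (Or.inl ⟨hb, hv'⟩)
        · exact Or.inr (Or.inr (ih' (Or.inr (Or.inr hb)) hv'))
    · have hvls : v ∈ ls.flatten := hbefore.subset (by simp)
      have hvl : v ∉ l := fun hvl => h1.notMem hvls (Or.inr hvl)
      exact Or.inr (Or.inr (ih h1 hbefore (hv.resolve_left hvl)))

/-- Of two dependent slots, at most one is executed in only one of two execution sequences. -/
theorem ExecSeq.mem_or_mem (hG : ∀ u v w, G u v → w.coord = v.coord → w.seq ≤ v.seq → G u w)
    {ls ls' : List (List (Slot f))} (h : ExecSeq G k E ls) (h' : ExecSeq G k E ls') {u v : Slot f}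
    (huv : G u v ∨ G v u) (hu : u ∈ ls.flatten) (hv : v ∈ ls'.flatten) :
    v ∈ ls.flatten ∨ u ∈ ls'.flatten := by
  induction h' generalizing ls with
  | nil => simp at hv
  | @cons E l ls' hl hls' ih =>
    rw [List.flatten_cons, List.mem_append] at hv ⊢
    rcases h.residual hG hl with ⟨A, B, rfl, h1, h2⟩ | ⟨h1, h2⟩
    · simp only [List.flatten_append, List.flatten_cons, List.mem_append] at hu ih ⊢
      by_cases hvl : v ∈ l
      · exact Or.inl (Or.inr (Or.inl hvl))
      by_cases hul : u ∈ l
      · exact Or.inr (Or.inl hul)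
      have := ih (ls := A ++ B) h1 (by simpa [hul] using hu) (hv.resolve_left hvl)
      simp only [List.flatten_append, List.mem_append] at this
      tauto
    · by_cases hvl : v ∈ l
      · exact absurd huv (h2 u hu v hvl)
      · exact (ih h1 hu (hv.resolve_left hvl)).imp_right Or.inr

/-! ## The executed requests -/

section Requests

theorem runRequests_concat (l : List (Request Client Op)) (r : Request Client Op) :
    ((∃ q ∈ runRequests l, q.client = r.client ∧ q.timestamp = r.timestamp) ∧
      runRequests (l ++ [r]) = runRequests l) ∨
    ((¬ ∃ q ∈ runRequests l, q.client = r.client ∧ q.timestamp = r.timestamp) ∧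
      runRequests (l ++ [r]) = runRequests l ++ [r]) := by
  by_cases h : ∃ q ∈ runRequests l, q.client = r.client ∧ q.timestamp = r.timestamp
  · refine Or.inl ⟨h, ?_⟩
    unfold runRequests at h ⊢
    rw [List.foldl_concat, if_pos h]
  · refine Or.inr ⟨h, ?_⟩
    unfold runRequests at h ⊢
    rw [List.foldl_concat, if_neg h]

theorem runRequests_prefix (l m : List (Request Client Op)) :
    runRequests l <+: runRequests (l ++ m) := by
  induction m using List.reverseRecOn with
  | nil => simp
  | append_singleton m r ih =>
    rw [← List.append_assoc]
    rcases runRequests_concat (l ++ m) r with ⟨-, h⟩ | ⟨-, h⟩ <;> rw [h]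
    · exact ih
    · exact ih.trans (List.prefix_append _ _)

theorem mem_of_mem_runRequests {l : List (Request Client Op)} {q : Request Client Op}
    (h : q ∈ runRequests l) : q ∈ l := by
  induction l using List.reverseRecOn with
  | nil => exact h
  | append_singleton l r ih =>
    rw [List.mem_append]
    rcases runRequests_concat l r with ⟨-, h'⟩ | ⟨-, h'⟩ <;> rw [h'] at h
    · exact Or.inl (ih h)
    · exact (List.mem_append.1 h).imp_left ih

theorem exists_mem_runRequests {l : List (Request Client Op)} {q : Request Client Op}
    (h : q ∈ l) : ∃ q' ∈ runRequests l, q'.client = q.client ∧ q'.timestamp = q.timestamp := by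
  induction l using List.reverseRecOn with
  | nil => simp at h
  | append_singleton l r ih =>
    rcases List.mem_append.1 h with h | h
    · obtain ⟨q', h1, h2⟩ := ih h
      exact ⟨q', (runRequests_prefix l [r]).subset h1, h2⟩
    · obtain rfl := List.mem_singleton.1 h
      rcases runRequests_concat l q with ⟨h1, h'⟩ | ⟨-, h'⟩ <;> rw [h']
      · exact h1
      · exact ⟨q, by simp, rfl, rfl⟩

-- Duplicates are recognised by client and timestamp, so whether a request is skipped depends only
-- on requests of its own client.
open Classical in
theorem filter_runRequests (l : List (Request Client Op)) (x : Client) :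
    (runRequests l).filter (fun r => r.client = x) =
      runRequests (l.filter (fun r => r.client = x)) := by
  induction l using List.reverseRecOn with
  | nil => rfl
  | append_singleton l r ih =>
    rw [List.filter_append]
    by_cases hr : r.client = x
    · have hsingle : [r].filter (fun r => (r.client = x : Bool)) = [r] := by simp [hr]
      rw [hsingle]
      have hiff : (∃ q ∈ runRequests l, q.client = r.client ∧ q.timestamp = r.timestamp) ↔
          ∃ q ∈ runRequests (l.filter (fun r => r.client = x)),
            q.client = r.client ∧ q.timestamp = r.timestamp := by
        rw [← ih]
        simp only [List.mem_filter, decide_eq_true_eq]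
        constructor
        · rintro ⟨q, h1, h2, h3⟩
          exact ⟨q, ⟨h1, h2.trans hr⟩, h2, h3⟩
        · rintro ⟨q, h1, h2⟩
          exact ⟨q, h1.1, h2⟩
      rcases runRequests_concat l r with ⟨h1, h2⟩ | ⟨h1, h2⟩ <;>
        rcases runRequests_concat (l.filter (fun r => r.client = x)) r with ⟨h3, h4⟩ | ⟨h3, h4⟩
      · rw [h2, h4, ih]
      · exact absurd (hiff.1 h1) h3
      · exact absurd (hiff.2 h3) h1
      · rw [h2, h4, List.filter_append, ih, hsingle]
    · have hsingle : [r].filter (fun r => (r.client = x : Bool)) = [] := by simp [hr]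
      rw [hsingle, List.append_nil, ← ih]
      rcases runRequests_concat l r with ⟨-, h⟩ | ⟨-, h⟩ <;> rw [h]
      rw [List.filter_append, hsingle, List.append_nil]

/-- A request is run at its first occurrence, if no duplicate occurs before. -/
theorem exists_of_runRequests_eq {l l₁ l₂ : List (Request Client Op)} {b : Request Client Op}
    (h : runRequests l = l₁ ++ b :: l₂) : ∃ x y, l = x ++ b :: y ∧ runRequests x = l₁ ∧
      ∀ q ∈ x, ¬ (q.client = b.client ∧ q.timestamp = b.timestamp) := by
  induction l using List.reverseRecOn generalizing l₂ with
  | nil => simp [runRequests] at h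
  | append_singleton l r ih =>
    have hold : ∀ {l₂}, runRequests l = l₁ ++ b :: l₂ → ∃ x y, l ++ [r] = x ++ b :: y ∧
        runRequests x = l₁ ∧ ∀ q ∈ x, ¬ (q.client = b.client ∧ q.timestamp = b.timestamp) := by
      intro l₂ h
      obtain ⟨x, y, rfl, h1, h2⟩ := ih h
      exact ⟨x, y ++ [r], by simp, h1, h2⟩
    rcases runRequests_concat l r with ⟨-, h'⟩ | ⟨hno, h'⟩ <;> rw [h'] at h
    · exact hold h
    · rcases List.eq_nil_or_concat' l₂ with rfl | ⟨l₂, c, rfl⟩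
      · obtain ⟨h1, h2⟩ := List.append_inj' h rfl
        obtain rfl : r = b := by simpa using h2
        refine ⟨l, [], rfl, h1, fun q hq hqr => hno ?_⟩
        obtain ⟨q', a1, a2, a3⟩ := exists_mem_runRequests hq
        exact ⟨q', a1, a2.trans hqr.1, a3.trans hqr.2⟩
      · have : runRequests l ++ [r] = (l₁ ++ b :: l₂) ++ [c] := by simpa using h
        exact hold (List.append_inj' this rfl).1

theorem mem_runRequests_of_first {x y : List (Request Client Op)} {a : Request Client Op}
    (h : ∀ q ∈ x, ¬ (q.client = a.client ∧ q.timestamp = a.timestamp)) :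
    a ∈ runRequests (x ++ a :: y) := by
  have : runRequests (x ++ [a]) <+: runRequests (x ++ a :: y) := by
    have := runRequests_prefix (x ++ [a]) y
    rwa [List.append_assoc] at this
  refine this.subset ?_
  rcases runRequests_concat x a with ⟨⟨q, h1, h2⟩, -⟩ | ⟨-, h'⟩
  · exact absurd h2 (h q (mem_of_mem_runRequests h1))
  · rw [h']
    simp

theorem filterMap_eq_append_cons {α β : Type*} {g : α → Option β} {l : List α} {x y : List β}
    {b : β} (h : l.filterMap g = x ++ b :: y) :
    ∃ l₁ s l₂, l = l₁ ++ s :: l₂ ∧ l₁.filterMap g = x ∧ g s = some b := by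
  obtain ⟨l₁, l₂, rfl, h1, h2⟩ := List.filterMap_eq_append_iff.1 h
  obtain ⟨l₃, s, l₄, rfl, h3, h4, -⟩ := List.filterMap_eq_cons_iff.1 h2
  refine ⟨l₁ ++ l₃, s, l₄, by simp, ?_, h4⟩
  rw [List.filterMap_append, h1, List.filterMap_eq_nil_iff.2 h3, List.append_nil]

theorem pair_sublist_iff_mem {α : Type*} {d₁ d₂ : List α} {u v : α}
    (h : (d₁ ++ v :: d₂).Nodup) : [u, v].Sublist (d₁ ++ v :: d₂) ↔ u ∈ d₁ := by
  rw [List.nodup_append, List.nodup_cons] at h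
  obtain ⟨-, ⟨h1, -⟩, h2⟩ := h
  rw [pair_sublist_append]
  constructor
  · rintro (h | ⟨h, -⟩ | h)
    · exact absurd rfl (h2 v (h.subset (by simp)) v (by simp))
    · exact h
    · rcases List.sublist_cons_iff.1 h with h | ⟨r, hr, h⟩
      · exact absurd (h.subset (by simp)) h1
      · obtain ⟨-, rfl⟩ := List.cons.inj hr
        exact absurd (h.subset (by simp)) h1
  · exact fun h => Or.inr (Or.inl ⟨h, by simp⟩)

theorem pair_sublist_of_cons {α : Type*} {a u v : α} {l : List α} (h : [u, v].Sublist (a :: l))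
    (hu : u ≠ a) : [u, v].Sublist l := by
  rcases List.sublist_cons_iff.1 h with h | ⟨r, hr, -⟩
  · exact h
  · exact absurd (List.cons.inj hr).1 hu

/-- Two lists that agree on the order of their elements are comparable, if of any two elements
at most one is in only one of the lists. -/
theorem prefix_or_prefix {α : Type*} {l l' : List α} (hl : l.Nodup) (hl' : l'.Nodup)
    (h : ∀ u v, [u, v].Sublist l → v ∈ l' → [u, v].Sublist l')
    (h' : ∀ u v, [u, v].Sublist l' → v ∈ l → [u, v].Sublist l)
    (hx : ∀ u ∈ l, ∀ v ∈ l', v ∈ l ∨ u ∈ l') : l <+: l' ∨ l' <+: l := by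
  induction l generalizing l' with
  | nil => exact Or.inl (List.nil_prefix)
  | cons a l ih =>
    rcases l' with _ | ⟨b, l'⟩
    · exact Or.inr (List.nil_prefix)
    obtain ⟨ha, hla⟩ := List.nodup_cons.1 hl
    obtain ⟨hb, hlb⟩ := List.nodup_cons.1 hl'
    have hpair : ∀ {c d : α} {m : List α}, d ∈ m → [c, d].Sublist (c :: m) := fun hd =>
      (List.singleton_sublist.2 hd).cons_cons _
    by_cases hab : a = b
    · subst hab
      have := ih (l' := l') hla hlb
        (fun u v huv hv => pair_sublist_of_cons (h u v (huv.cons a) (List.mem_cons_of_mem _ hv))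
          fun hu => ha (hu ▸ huv.subset (by simp)))
        (fun u v huv hv => pair_sublist_of_cons (h' u v (huv.cons a) (List.mem_cons_of_mem _ hv))
          fun hu => hb (hu ▸ huv.subset (by simp)))
        (fun u hu v hv => (hx u (List.mem_cons_of_mem _ hu) v (List.mem_cons_of_mem _ hv)).imp
          (fun hm => (List.mem_cons.1 hm).resolve_left fun e => by subst e; exact hb hv)
          (fun hm => (List.mem_cons.1 hm).resolve_left fun e => by subst e; exact ha hu))
      exact this.imp (fun h => (List.prefix_cons_inj a).2 h) fun h => (List.prefix_cons_inj a).2 h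
    · exfalso
      -- If the heads differ, one of them occurs later in the other list. Transferring that order
      -- puts a head strictly behind the other element, so it would occur twice.
      rcases hx a (by simp) b (by simp) with hm | hm
      · have hm := (List.mem_cons.1 hm).resolve_left (Ne.symm hab)
        exact hb ((pair_sublist_of_cons (h a b (hpair hm) (by simp)) hab).subset (by simp))
      · have hm := (List.mem_cons.1 hm).resolve_left hab
        exact ha ((pair_sublist_of_cons (h' b a (hpair hm) (by simp)) (Ne.symm hab)).subset
          (by simp))

end Requests

/-! ## Execution along a run -/

section Step

variable {conf : Request Client Op → Request Client Op → Prop} {k : ℕ}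

theorem Local.setSlot_exec {L : Local f Client Op} {s s' : Slot f} {S : SlotState f Client Op}
    {x : Decision f Client Op} (h : (L.slots s').exec = some x)
    (hS : ∀ x, (L.slots s).exec = some x → S.exec = some x) :
    ((L.setSlot s S).slots s').exec = some x := by
  by_cases hs : s' = s
  · subst hs
    rw [Local.setSlot_same]
    exact hS x h
  · rwa [Local.setSlot_ne _ _ hs]

/-- A decision is never overwritten: `SlotState.decide` keeps an existing one, and `learnExec`
applies only where there is none. -/
theorem LocalStep.exec_stable {issued : Set (Request Client Op)} {sent out : Set (Msg f Client Op)}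
    {i : Replica f} {L L' : Local f Client Op} (h : LocalStep conf k issued sent i L L' out)
    {s : Slot f} {x : Decision f Client Op} (hx : (L.slots s).exec = some x) :
    (L'.slots s).exec = some x := by
  cases h with
  | fpCommit =>
    exact Local.setSlot_exec hx fun x hx => by simp [SlotState.decide, hx]
  | rpCommit =>
    exact Local.setSlot_exec hx fun x hx => by simp [SlotState.decide, hx]
  | sendNewView nv =>
    rw [Local.enter_slots]
    exact Local.setSlot_exec hx fun x hx => hx
  | acceptNewView nv =>
    rw [Local.enter_slots]
    exact Local.setSlot_exec hx fun x hx => hx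
  | learnExec s y M hnone =>
    exact Local.setSlot_exec hx fun x hx => by simp [hnone] at hx
  | sendExec => exact hx
  | executeNormal => exact hx
  | executeUnblock => exact hx
  | _ => exact Local.setSlot_exec (L := L) hx fun x hx => hx

/-- The dependency graph `G` agrees with that of `L` on the slots that are committed in `L`. -/
theorem Local.enabled_of_isFirstComponent {L : Local f Client Op} {G : Slot f → Slot f → Prop}
    (hG : ∀ u v, u ∈ L.committed → (G u v ↔ L.Dep u v)) {A : Set (Slot f)} {v : Slot f}
    (hA : L.pending ∩ L.window k ⊆ A)
    (hr : L.rdeps A v ⊆ L.committed ∩ (L.pending ∩ L.window k)) {l : List (Slot f)}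
    (hl : l.Pairwise SlotBefore) (hcomp : L.IsFirstComponent (L.rdeps A v) {u | u ∈ l}) :
    Enabled G k {u | u ∈ L.done} l ∧ ∀ u ∈ l, u ∈ L.committed := by
  obtain ⟨⟨z, hz⟩, hsub, hconn, hclosed⟩ := hcomp
  refine ⟨⟨List.ne_nil_of_mem hz, hl, fun x hx => (hr (hsub hx)).2, fun x hx y hy => ?_,
    fun x hx y hy hxy => ?_⟩, fun u hu => (hr (hsub hu)).1⟩
  -- A path in the expanded graph that starts in the component cannot leave it, since no edge leads
  -- out; so connectivity in the graph is connectivity inside `l`.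
  · suffices h : y ∈ l ∧ Relation.ReflTransGen (fun x y => G x y ∧ y ∈ l) x y from h.2
    have hpath := (hconn x hx y hy).2
    clear hy
    induction hpath with
    | refl => exact ⟨hx, .refl⟩
    | @tail b c _ hbc ih =>
      have hc : c ∈ l := hclosed b ih.1 c hbc.2 hbc.1
      exact ⟨hc, ih.2.tail ⟨(hG b c (hr (hsub ih.1)).1).2 hbc.1, hc⟩⟩
  · have hd := (hG x y (hr (hsub hx)).1).1 hxy
    exact hclosed x hx y ⟨(hsub hx).1, (hsub hx).2.tail ⟨hd, hA hy⟩⟩ hd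

/-- Both execution modes become `Enabled` here. In the normal case the expanded graph happens to lie
in the window; in the unblock case it is cut off at the window. -/
theorem LocalStep.done_eq {issued : Set (Request Client Op)} {sent out : Set (Msg f Client Op)}
    {i : Replica f} {L L' : Local f Client Op} (h : LocalStep conf k issued sent i L L' out)
    {G : Slot f → Slot f → Prop} (hG : ∀ u v, u ∈ L.committed → (G u v ↔ L.Dep u v)) :
    L'.done = L.done ∨ ∃ l, L'.done = L.done ++ l ∧ Enabled G k {u | u ∈ L.done} l ∧
      ∀ u ∈ l, u ∈ L.committed := by
  cases h with
  | sendNewView nv => left; unfold Local.enter; split <;> rfl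
  | acceptNewView nv => left; unfold Local.enter; split <;> rfl
  | executeNormal v l hv hl hcomp =>
    refine Or.inr ⟨l, rfl, Local.enabled_of_isFirstComponent hG Set.inter_subset_left ?_ hl hcomp⟩
    intro u hu
    refine ⟨(hv.2 hu).1, ?_, (hv.2 hu).2⟩
    rcases hu.2.cases_tail with rfl | ⟨_, -, h⟩
    · exact hu.1
    · exact h.2
  | executeUnblock v l hv hl hcomp =>
    refine Or.inr ⟨l, rfl, Local.enabled_of_isFirstComponent hG subset_rfl ?_ hl hcomp⟩
    intro u hu
    refine ⟨hv.2.2 hu, ?_⟩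
    rcases hu.2.cases_tail with rfl | ⟨_, -, h⟩
    · exact hu.1
    · exact h.2
  | _ => exact Or.inl rfl

end Step

section Run

variable {conf : Request Client Op → Request Client Op → Prop} {k : ℕ}
  {faulty : Finset (Replica f)} {σ : ℕ → Config f Client Op}

/-- The dependencies between slots at any correct replica and at any time. -/
def RunDep (faulty : Finset (Replica f)) (σ : ℕ → Config f Client Op) (u v : Slot f) : Prop :=
  ∃ r ∉ faulty, ∃ t, ((σ t).loc r).Dep u v

theorem RunDep.down {u v w : Slot f} (h : RunDep faulty σ u v) (hc : w.coord = v.coord)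
    (hs : w.seq ≤ v.seq) : RunDep faulty σ u w := by
  obtain ⟨r, hr, t, x, hx, d, hd, h1, h2⟩ := h
  exact ⟨r, hr, t, x, hx, d, hd, hc.trans h1, hs.trans h2⟩

theorem Covers.runDep {r : Replica f} (hr : r ∉ faulty) {t : ℕ} {s s' : Slot f}
    {x : Decision f Client Op} (hx : (((σ t).loc r).slots s).exec = some x) (h : Covers x.2 s') :
    RunDep faulty σ s s' :=
  ⟨r, hr, t, x, hx, h⟩

variable (hσ : IsRun conf k faulty σ)
include hσ

theorem IsRun.exec_stable {r : Replica f} {t t' : ℕ} (htt : t ≤ t') {s : Slot f}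
    {x : Decision f Client Op} (h : (((σ t).loc r).slots s).exec = some x) :
    (((σ t').loc r).slots s).exec = some x := by
  induction t', htt using Nat.le_induction with
  | base => exact h
  | succ t' _ ih =>
    have hstep := hσ.2 t'
    -- Case analysis on a step requires variables as indices.
    generalize σ t' = c, σ (t' + 1) = c' at hstep ih
    cases hstep with
    | correct j L' out hj hloc =>
      by_cases hij : r = j
      · subst hij
        simpa using hloc.exec_stable ih
      · simpa [Function.update_of_ne hij] using ih
    | _ => exact ih

/-- Correct replicas agree on the decisions. -/
theorem IsRun.agreement (hfaulty : faulty.card ≤ f) {r r' : Replica f} (hr : r ∉ faulty)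
    (hr' : r' ∉ faulty) {t t' : ℕ} {s : Slot f} {x x' : Decision f Client Op}
    (h : (((σ t).loc r).slots s).exec = some x) (h' : (((σ t').loc r').slots s).exec = some x') :
    x = x' := by
  have h1 := hσ.exec_stable (le_max_left t t') h
  have h2 := hσ.exec_stable (le_max_right t t') h'
  -- For f = 0 the DepVerify sets are empty and do not identify a proposal, but there is only one
  -- replica, and its decisions are stable.
  rcases eq_or_ne f 0 with rfl | hf
  · obtain rfl : r = r' := Subsingleton.elim (α := Fin 1) r r'
    exact Option.some.inj (h1.symm.trans h2)
  · exact Justified.unique hfaulty (hσ.inv hfaulty _) hf (hσ.exec_justified hfaulty hr h1)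
      (hσ.exec_justified hfaulty hr' h2)

/-- By agreement every correct replica attaches the same dependencies to a committed slot, so the
local graph is the global one on all slots that execution consults. -/
theorem IsRun.runDep_iff (hfaulty : faulty.card ≤ f) {r : Replica f} (hr : r ∉ faulty) {t : ℕ}
    (u v : Slot f) (hu : u ∈ ((σ t).loc r).committed) :
    RunDep faulty σ u v ↔ ((σ t).loc r).Dep u v := by
  refine ⟨?_, fun h => ⟨r, hr, t, h⟩⟩
  rintro ⟨r', hr', t', x, hx, hd⟩
  obtain ⟨y, hy⟩ := Option.ne_none_iff_exists'.1 hu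
  obtain rfl := hσ.agreement hfaulty hr hr' hy hx
  exact ⟨y, hy, hd⟩

/-- Reduces executions to combinatorics: all correct replicas run execution sequences of one graph,
starting from the empty set, which is what confluence compares. -/
theorem IsRun.execSeq (hfaulty : faulty.card ≤ f) {r : Replica f} (hr : r ∉ faulty) (t : ℕ) :
    (∃ ls, ExecSeq (RunDep faulty σ) k ∅ ls ∧ ((σ t).loc r).done = ls.flatten) ∧
      ∀ s ∈ ((σ t).loc r).done, ∃ x, (((σ t).loc r).slots s).exec = some x := by
  induction t with
  | zero =>
    rw [hσ.1]
    exact ⟨⟨[], .nil _, rfl⟩, by simp [Config.initial, Local.initial]⟩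
  | succ t ih =>
    have hdone : ((σ (t + 1)).loc r).done = ((σ t).loc r).done ∨ ∃ l,
        ((σ (t + 1)).loc r).done = ((σ t).loc r).done ++ l ∧
        Enabled (RunDep faulty σ) k {u | u ∈ ((σ t).loc r).done} l ∧
        ∀ u ∈ l, u ∈ ((σ t).loc r).committed := by
      have hG := hσ.runDep_iff hfaulty hr (t := t)
      have hstep := hσ.2 t
      generalize RunDep faulty σ = G at hG
      generalize σ t = c, σ (t + 1) = c' at hstep hG
      cases hstep with
      | correct j L' out hj hloc =>
        by_cases hij : r = j
        · subst hij
          simpa using hloc.done_eq hG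
        · simp [Function.update_of_ne hij]
      | _ => exact Or.inl rfl
    obtain ⟨⟨ls, hls, hflat⟩, hcom⟩ := ih
    rcases hdone with hd | ⟨l, hd, hl, hlc⟩
    · rw [hd]
      refine ⟨⟨ls, hls, hflat⟩, fun s hs => ?_⟩
      obtain ⟨x, hx⟩ := hcom s hs
      exact ⟨x, hσ.exec_stable t.le_succ hx⟩
    · rw [hd]
      refine ⟨⟨ls ++ [l], hls.concat ?_, by simp [hflat]⟩, fun s hs => ?_⟩
      · rwa [Set.empty_union, ← hflat]
      · obtain ⟨x, hx⟩ : ∃ x, (((σ t).loc r).slots s).exec = some x :=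
          (List.mem_append.1 hs).elim (hcom s) fun h => Option.ne_none_iff_exists'.1 (hlc s h)
        exact ⟨x, hσ.exec_stable t.le_succ hx⟩

end Run

/-! ## Linearizability -/

/-- The request that is committed for slot `s`, if there is one and it is not a no-op. -/
def Local.request (L : Local f Client Op) (s : Slot f) : Option (Request Client Op) :=
  (L.slots s).exec.bind Prod.fst

theorem Local.request_eq_some {L : Local f Client Op} {s : Slot f} {a : Request Client Op} :
    L.request s = some a ↔ ∃ D, (L.slots s).exec = some (some a, D) := by
  simp [Local.request, Option.bind_eq_some_iff]

theorem Local.log_eq (L : Local f Client Op) :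
    L.log = runRequests (L.done.filterMap L.request) := rfl

open Classical in
/-- The executed slots with a request of client `x`. -/
noncomputable def Local.clientSlots (L : Local f Client Op) (x : Client) : List (Slot f) :=
  L.done.filter fun s => ∃ a, L.request s = some a ∧ a.client = x

theorem Local.mem_clientSlots {L : Local f Client Op} {x : Client} {s : Slot f} :
    s ∈ L.clientSlots x ↔ s ∈ L.done ∧ ∃ a, L.request s = some a ∧ a.client = x := by
  classical
  unfold Local.clientSlots
  rw [List.mem_filter, decide_eq_true_iff]

theorem Local.clientLog_eq (L : Local f Client Op) (x : Client) :
    L.clientLog x = runRequests ((L.clientSlots x).filterMap L.request) := by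
  classical
  unfold Local.clientLog Local.clientSlots
  rw [Local.log_eq, filter_runRequests, List.filter_filterMap, List.filterMap_filter]
  congr 2
  funext s
  cases h : L.request s with
  | none => simp
  | some a => by_cases ha : a.client = x <;> simp [ha]

theorem Conflict.symm {AppState Result : Type*} {app : AppState → Client → Op → AppState × Result}
    {a b : Request Client Op} (h : Conflict app a b) : Conflict app b a := by
  rcases h with h | ⟨st, h⟩
  · exact Or.inl h.symm
  · refine Or.inr ⟨st, ?_⟩
    rcases h with h | h | h
    · exact Or.inl (Ne.symm h)
    · exact Or.inr (Or.inr h)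
    · exact Or.inr (Or.inl h)

variable {conf : Request Client Op → Request Client Op → Prop} {k : ℕ}
  {faulty : Finset (Replica f)} {σ : ℕ → Config f Client Op} (hσ : IsRun conf k faulty σ)
  (hfaulty : faulty.card ≤ f)
include hσ hfaulty

theorem IsRun.done_nodup {r : Replica f} (hr : r ∉ faulty) (t : ℕ) :
    ((σ t).loc r).done.Nodup := by
  obtain ⟨⟨ls, hls, h⟩, -⟩ := hσ.execSeq hfaulty hr t
  exact h ▸ hls.nodup

theorem IsRun.done_order {r r' : Replica f} (hr : r ∉ faulty) (hr' : r' ∉ faulty) {t t' : ℕ}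
    {u v : Slot f} (huv : RunDep faulty σ u v ∨ RunDep faulty σ v u)
    (h : [u, v].Sublist ((σ t).loc r).done) (hv : v ∈ ((σ t').loc r').done) :
    [u, v].Sublist ((σ t').loc r').done := by
  obtain ⟨⟨ls, hls, h1⟩, -⟩ := hσ.execSeq hfaulty hr t
  obtain ⟨⟨ls', hls', h2⟩, -⟩ := hσ.execSeq hfaulty hr' t'
  rw [h1] at h
  rw [h2] at hv ⊢
  exact hls.order (G := RunDep faulty σ) (fun _ _ _ h => h.down) hls' huv h hv

theorem IsRun.mem_done_or {r r' : Replica f} (hr : r ∉ faulty) (hr' : r' ∉ faulty) {t t' : ℕ}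
    {u v : Slot f} (huv : RunDep faulty σ u v ∨ RunDep faulty σ v u)
    (hu : u ∈ ((σ t).loc r).done) (hv : v ∈ ((σ t').loc r').done) :
    v ∈ ((σ t).loc r).done ∨ u ∈ ((σ t').loc r').done := by
  obtain ⟨⟨ls, hls, h1⟩, -⟩ := hσ.execSeq hfaulty hr t
  obtain ⟨⟨ls', hls', h2⟩, -⟩ := hσ.execSeq hfaulty hr' t'
  rw [h1] at hu ⊢
  rw [h2] at hv ⊢
  exact hls.mem_or_mem (G := RunDep faulty σ) (fun _ _ _ h => h.down) hls' huv hu hv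

theorem IsRun.request_eq {r r' : Replica f} (hr : r ∉ faulty) (hr' : r' ∉ faulty) {t t' : ℕ}
    {s : Slot f} (h : s ∈ ((σ t).loc r).done) (h' : s ∈ ((σ t').loc r').done) :
    ((σ t).loc r).request s = ((σ t').loc r').request s := by
  obtain ⟨x, hx⟩ := (hσ.execSeq hfaulty hr t).2 s h
  obtain ⟨x', hx'⟩ := (hσ.execSeq hfaulty hr' t').2 s h'
  rw [Local.request, Local.request, hx, hx', hσ.agreement hfaulty hr hr' hx hx']

theorem IsRun.runDep_of_conflict (hsymm : ∀ a b, conf a b → conf b a) {r r' : Replica f}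
    (hr : r ∉ faulty) (hr' : r' ∉ faulty) {t t' : ℕ} {u v : Slot f} (huv : u ≠ v)
    {a b : Request Client Op} (hab : conf a b) (ha : ((σ t).loc r).request u = some a)
    (hb : ((σ t').loc r').request v = some b) : RunDep faulty σ u v ∨ RunDep faulty σ v u := by
  obtain ⟨D, hD⟩ := Local.request_eq_some.1 ha
  obtain ⟨D', hD'⟩ := Local.request_eq_some.1 hb
  exact (hσ.covers_of_conflict hfaulty hsymm hr hr' huv hab hD hD').symm.imp
    (Covers.runDep hr hD) (Covers.runDep hr' hD')

theorem IsRun.clientSlots_order (hsymm : ∀ a b, conf a b → conf b a)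
    (hclient : ∀ a b : Request Client Op, a.client = b.client → conf a b) {r r' : Replica f}
    (hr : r ∉ faulty) (hr' : r' ∉ faulty) {t t' : ℕ} {x : Client} {u v : Slot f}
    (h : [u, v].Sublist (((σ t).loc r).clientSlots x)) (hv : v ∈ ((σ t').loc r').clientSlots x) :
    [u, v].Sublist (((σ t').loc r').clientSlots x) := by
  classical
  have hsub := h.trans List.filter_sublist
  have hne : u ≠ v := by
    simpa using hsub.nodup (hσ.done_nodup hfaulty hr t)
  obtain ⟨hu1, a, ha, hax⟩ := Local.mem_clientSlots.1 (h.subset (by simp : u ∈ [u, v]))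
  obtain ⟨hv1, b, hb, hbx⟩ := Local.mem_clientSlots.1 hv
  have hdep := hσ.runDep_of_conflict hfaulty hsymm hr hr' hne (hclient a b (hax.trans hbx.symm))
    ha hb
  have hord := hσ.done_order hfaulty hr hr' hdep hsub hv1
  have hua := hσ.request_eq hfaulty hr hr' hu1 (hord.subset (by simp : u ∈ [u, v]))
  have hfil := hord.filter fun s => decide (∃ a, ((σ t').loc r').request s = some a ∧ a.client = x)
  rw [List.filter_eq_self.2] at hfil
  · exact hfil
  · intro s hs
    rw [decide_eq_true_iff]
    rcases List.mem_pair.1 hs with rfl | rfl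
    · exact ⟨a, hua ▸ ha, hax⟩
    · exact ⟨b, hb, hbx⟩

/-- Any two correct replicas execute the requests of a client in the same order. -/
theorem IsRun.clientLog_prefix (hsymm : ∀ a b, conf a b → conf b a)
    (hclient : ∀ a b : Request Client Op, a.client = b.client → conf a b) {r r' : Replica f}
    (hr : r ∉ faulty) (hr' : r' ∉ faulty) (t t' : ℕ) (x : Client) :
    ((σ t).loc r).clientLog x <+: ((σ t').loc r').clientLog x ∨
      ((σ t').loc r').clientLog x <+: ((σ t).loc r).clientLog x := by
  have hpre : ∀ {r r' t t'}, r ∉ faulty → r' ∉ faulty →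
      ((σ t).loc r).clientSlots x <+: ((σ t').loc r').clientSlots x →
      ((σ t).loc r).clientLog x <+: ((σ t').loc r').clientLog x := by
    rintro r r' t t' hr hr' hp
    have heq : (((σ t).loc r).clientSlots x).filterMap ((σ t).loc r).request =
        (((σ t).loc r).clientSlots x).filterMap ((σ t').loc r').request :=
      List.filterMap_congr fun s hs => hσ.request_eq hfaulty hr hr'
        (Local.mem_clientSlots.1 hs).1 (Local.mem_clientSlots.1 (hp.subset hs)).1
    obtain ⟨m, hm⟩ := hp
    rw [Local.clientLog_eq, Local.clientLog_eq, heq, ← hm, List.filterMap_append]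
    exact runRequests_prefix _ _
  have hnodup : ∀ {r t}, r ∉ faulty → (((σ t).loc r).clientSlots x).Nodup := fun hr =>
    List.filter_sublist.nodup (hσ.done_nodup hfaulty hr _)
  -- Slots of one client carry conflicting requests and are pairwise dependent, so confluence gives
  -- a total order on them. Comparing slots instead of requests avoids trouble with requests that
  -- occur repeatedly.
  refine (prefix_or_prefix (hnodup hr) (hnodup hr')
    (fun u v => hσ.clientSlots_order hfaulty hsymm hclient hr hr')
    (fun u v => hσ.clientSlots_order hfaulty hsymm hclient hr' hr) ?_).imp
    (hpre hr hr') (hpre hr' hr)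
  intro u hu v hv
  rcases eq_or_ne u v with rfl | hne
  · exact Or.inl hu
  obtain ⟨hu1, a, ha, hax⟩ := Local.mem_clientSlots.1 hu
  obtain ⟨hv1, b, hb, hbx⟩ := Local.mem_clientSlots.1 hv
  have hdep := hσ.runDep_of_conflict hfaulty hsymm hr hr' hne (hclient a b (hax.trans hbx.symm))
    ha hb
  rcases hσ.mem_done_or hfaulty hr hr' hdep hu1 hv1 with h | h
  · exact Or.inl (Local.mem_clientSlots.2
      ⟨h, b, (hσ.request_eq hfaulty hr hr' h hv1).trans hb, hbx⟩)
  · exact Or.inr (Local.mem_clientSlots.2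
      ⟨h, a, (hσ.request_eq hfaulty hr hr' hu1 h).symm.trans ha, hax⟩)

theorem IsRun.proposed_of_request {r : Replica f} (hr : r ∉ faulty) {t : ℕ} {s : Slot f}
    {b : Request Client Op} (h : ((σ t).loc r).request s = some b) : (σ t).Proposed b := by
  obtain ⟨D, hD⟩ := Local.request_eq_some.1 h
  exact (hσ.exec_justified hfaulty hr hD).exists_witnesses.1

/-- A request that is proposed after a conflicting request has been executed at a correct replica
is executed after that request at all correct replicas. -/
theorem IsRun.mem_log_before (hsymm : ∀ a b, conf a b → conf b a)
    (hclient : ∀ a b : Request Client Op, a.client = b.client → conf a b) {r r' : Replica f}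
    (hr : r ∉ faulty) (hr' : r' ∉ faulty) {t t' : ℕ} {a b : Request Client Op} (hab : conf a b)
    (ha : a ∈ ((σ t).loc r).log) (hb : ¬ (σ t).Proposed b) {l₁ l₂ : List (Request Client Op)}
    (h : ((σ t').loc r').log = l₁ ++ b :: l₂) : a ∈ l₁ := by
  obtain ⟨m₁, m₂, hm⟩ := List.append_of_mem ha
  rw [Local.log_eq] at h hm
  obtain ⟨x, y, hxy, -, hfirst⟩ := exists_of_runRequests_eq hm
  obtain ⟨d₁, sa, d₂, hd, rfl, hsa⟩ := filterMap_eq_append_cons hxy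
  obtain ⟨x', y', hxy', rfl, -⟩ := exists_of_runRequests_eq h
  obtain ⟨e₁, sb, e₂, he, rfl, hsb⟩ := filterMap_eq_append_cons hxy'
  have hdn := hσ.done_nodup hfaulty hr t
  have hen := hσ.done_nodup hfaulty hr' t'
  have hsaD : sa ∈ ((σ t).loc r).done := by simp [hd]
  have hsbE : sb ∈ ((σ t').loc r').done := by simp [he]
  -- An executed slot with `b` would presuppose a DepPropose for `b` by time `t`.
  have hsbD : sb ∉ ((σ t).loc r).done := fun hmem =>
    hb (hσ.proposed_of_request hfaulty hr ((hσ.request_eq hfaulty hr hr' hmem hsbE).trans hsb))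
  have hne : sa ≠ sb := fun h => hsbD (h ▸ hsaD)
  have hdep := hσ.runDep_of_conflict hfaulty hsymm hr hr' hne hab hsa hsb
  -- `sb` is missing at `r`, so `sa` cannot also be missing at `r'`. Nor can `sa` come after `sb`
  -- there, since that order would carry over to `r` and put `sb` among its executed slots.
  have hsaE := (hσ.mem_done_or hfaulty hr hr' hdep hsaD hsbE).resolve_left hsbD
  have hsae : sa ∈ e₁ := by
    rw [he, List.mem_append, List.mem_cons] at hsaE
    rcases hsaE with h | h | h
    · exact h
    · exact absurd h hne
    · have hlt : [sb, sa].Sublist ((σ t').loc r').done := by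
        rw [he, pair_sublist_append]
        exact Or.inr (Or.inr ((List.singleton_sublist.2 h).cons_cons _))
      exact absurd ((hσ.done_order hfaulty hr' hr hdep.symm hlt hsaD).subset (by simp)) hsbD
  have hsa' : ((σ t').loc r').request sa = some a := by
    rw [← hsa]
    exact hσ.request_eq hfaulty hr' hr (by rw [he]; exact List.mem_append_left _ hsae) hsaD
  obtain ⟨g₁, g₂, rfl⟩ := List.append_of_mem hsae
  rw [List.append_assoc, List.cons_append] at he
  rw [List.filterMap_append, List.filterMap_cons_some hsa']
  -- It remains to exclude that `r'` skips `a` at `sa`. An earlier duplicate `q` has the same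
  -- client, so its slot depends on `sa` or conversely; the order carries over to `r`, where no
  -- duplicate precedes `sa`.
  refine mem_runRequests_of_first fun q hq hqa => ?_
  obtain ⟨s, hs, hsq⟩ := List.mem_filterMap.1 hq
  have hlt : [s, sa].Sublist ((σ t').loc r').done := by
    rw [he] at hen ⊢
    exact (pair_sublist_iff_mem hen).2 hs
  have hssa : s ≠ sa := by simpa using hlt.nodup hen
  have hsdep := hσ.runDep_of_conflict hfaulty hsymm hr' hr hssa (hclient q a hqa.1) hsq hsa
  have hltD := hσ.done_order hfaulty hr' hr hsdep hlt hsaD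
  have hsD : s ∈ ((σ t).loc r).done := hltD.subset (by simp)
  have hsE : s ∈ ((σ t').loc r').done := hlt.subset (by simp)
  rw [hd] at hdn hltD
  refine hfirst q (List.mem_filterMap.2 ⟨s, (pair_sublist_iff_mem hdn).1 hltD, ?_⟩) hqa
  exact (hσ.request_eq hfaulty hr hr' hsD hsE).trans hsq

end Isos

theorem mainTheorem6 {Client Op AppState Result : Type*}
    (app : AppState → Client → Op → AppState × Result) (f k : ℕ)
    (faulty : Finset (Isos.Replica f)) (hfaulty : faulty.card ≤ f)
    (σ : ℕ → Isos.Config f Client Op)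
    (hσ : Isos.IsRun (Isos.Conflict app) k faulty σ) :
    -- `a` is executed at the correct replica `r` at time `t`, and `b` has not been proposed by then
    (∀ (a b : Isos.Request Client Op), Isos.Conflict app a b →
      ∀ (r : Isos.Replica f) (t : ℕ), r ∉ faulty →
        a ∈ ((σ t).loc r).log → ¬ (σ t).Proposed b →
      ∀ (r' : Isos.Replica f) (t' : ℕ), r' ∉ faulty →
        -- every slot committed with `b` depends on every slot that `r` has executed with `a`
        (∀ (sa sb : Isos.Slot f) (Da Db : Finset (Isos.Slot f)),
          sa ∈ ((σ t).loc r).done → (((σ t).loc r).slots sa).exec = some (some a, Da) →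
          (((σ t').loc r').slots sb).exec = some (some b, Db) → ((σ t').loc r').Dep sb sa) ∧
        -- and whenever `r'` executes `b`, it has executed `a` before
        (∀ l₁ l₂ : List (Isos.Request Client Op),
          ((σ t').loc r').log = l₁ ++ b :: l₂ → a ∈ l₁)) ∧
    -- requests of the same client conflict, and are executed in one order at all correct replicas
    (∀ a b : Isos.Request Client Op, a.client = b.client → Isos.Conflict app a b) ∧
    (∀ (x : Client) (r r' : Isos.Replica f) (t t' : ℕ), r ∉ faulty → r' ∉ faulty →
      ((σ t).loc r).clientLog x <+: ((σ t').loc r').clientLog x ∨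
      ((σ t').loc r').clientLog x <+: ((σ t).loc r).clientLog x) := by
  have hsymm : ∀ a b : Isos.Request Client Op, Isos.Conflict app a b → Isos.Conflict app b a :=
    fun a b h => h.symm
  have hclient : ∀ a b : Isos.Request Client Op, a.client = b.client → Isos.Conflict app a b :=
    fun a b h => Or.inl h
  refine ⟨fun a b hab r t hr ha hb r' t' hr' => ⟨fun sa sb Da Db _ hsa hsb => ?_,
    fun l₁ l₂ h => ?_⟩, hclient, fun x r r' t t' hr hr' => ?_⟩
  · exact ⟨_, hsb, hσ.covers_of_not_proposed hfaulty hr hr' hab hsa hb hsb⟩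
  · exact hσ.mem_log_before hfaulty hsymm hclient hr hr' hab ha hb h
  · exact hσ.clientLog_prefix hfaulty hsymm hclient hr hr' t t' x
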